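/- Let $X$ be a reflexive real Banach space with dual $X^*$ and pairing $\langle\cdot,\cdot\rangle$. A function $f\colon X\to\,]-\infty,+\infty]$ belongs to $\Gamma_0(X)$ if it is convex, lower semicontinuous and $\operatorname{dom} f=\{f<+\infty\}\neq\varnothing$; $f^*(x^*)=\sup_{x\in X}(\langle x,x^*\rangle-f(x))$ is its conjugate and $\partial f$ its subdifferential. It is essentially smooth if $\partial f$ is locally bounded and single-valued on its domain, and essentially strictly convex if $\partial f^*$ is locally bounded on its domain and $f$ is strictly convex on every convex subset of $\operatorname{dom}\partial f$. It is supercoercive if $f(x)/\|x\|\to+\infty$ as $\|x\|\to+\infty$. It is uniformly convex if there is $\phi\colon[0,+\infty[\,\to[0,+\infty[$ vanishing only at $0$ such that $f(\lambda x+(1-\lambda)y)+\lambda(1-\lambda)\phi(\|x-y\|)\leq\lambda f(x)+(1-\lambda)f(y)$ for all $x,y\in\operatorname{dom} f$ and $\lambda\in\,]0,1[$. Gradients $\nabla f$ are Gâteaux gradients, with domain in $\operatorname{int}\operatorname{dom} f$. If $f$ is Gâteaux differentiable on $\operatorname{int}\operatorname{dom} f\neq\varnothing$, the Bregman distance is $D_f(x,y)=f(x)-f(y)-\langle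 x-y,\nabla f(y)\rangle$ if $y\in\operatorname{int}\operatorname{dom} f$, and $D_f(x,y)=+\infty$ otherwise. For $\alpha>0$, $\mathcal C_\alpha(f)$ is the set of all $g\in\Gamma_0(X)$ such that $\operatorname{dom} g=\operatorname{dom} f$, $g$ is Gâteaux differentiable on $\operatorname{int}\operatorname{dom} f$, and $D_g\geq\alpha D_f$. For $M\colon X\to2^{X^*}$, $\operatorname{dom} M=\{x: Mx\neq\varnothing\}$, $\operatorname{ran} M=\bigcup_{x}Mx$ and $\operatorname{zer} M=\{x:0\in Mx\}$. Problem. Let $A,B\colon X\to2^{X^*}$ be maximally monotone and let $f\in\Gamma_0(X)$ be essentially smooth. Set $C=(\operatorname{int}\operatorname{dom} f)\cap\operatorname{dom} A$ and $\mathscr S=(\operatorname{int}\operatorname{dom} f)\cap\operatorname{zer}(A+B)$. Suppose that $C\subset\operatorname{int}\operatorname{dom} B$, that $\mathscr S\neq\varnothing$, that $B$ is single-valued on $\operatorname{int}\operatorname{dom} B$, and that $\delta_1\in[0,1[$, $\delta_2\in[0,1]$ and $\kappa\in[0,+\infty[$ satisfy, for all $x,y\in C$, $z\in\mathscr S$,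 $y^*\in Ay$ and $z^*\in Az$, $$\langle y-x,By-Bz\rangle\leq\kappa D_f(x,y)+\langle y-z,\delta_1(y^*-z^*)+\delta_2(By-Bz)\rangle .$$ Algorithm. Let $\alpha>0$, let $(\gamma_n)_{n\in\mathbb N}$ be in $]0,+\infty[$ and let $(f_n)_{n\in\mathbb N}$ be in $\mathcal C_\alpha(f)$. Suppose that: [a] $\inf_n\gamma_n>0$, $\sup_n\kappa\gamma_n\leq\alpha$ and $\sup_n\delta_1\gamma_{n+1}/\gamma_n<1$; [b] there is a summable sequence $(\eta_n)_{n\in\mathbb N}$ in $[0,+\infty[$ with $D_{f_{n+1}}\leq(1+\eta_n)D_{f_n}$ for all $n$; [c] for all $n$, $\nabla f_n$ is strictly monotone on $C$ and $(\nabla f_n-\gamma_nB)(C)\subset\operatorname{ran}(\nabla f_n+\gamma_nA)$. Take $x_0\in C$ and set, for all $n\in\mathbb N$, $$x_{n+1}=(\nabla f_n+\gamma_nA)^{-1}\big(\nabla f_n(x_n)-\gamma_nBx_n\big).$$ Proposition. The sequence $(x_n)_{n\in\mathbb N}$ is well defined (for every $n$ and $p\in C$, $(\nabla f_n+\gamma_nA)^{-1}(\nabla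 f_n(p)-\gamma_nBp)$ consists of exactly one point, which lies in $C$, so that exactly one such sequence exists) and lies in $C$. For every $z\in\mathscr S$: (i) $(D_{f_n}(z,x_n))_{n\in\mathbb N}$ converges to a real number. (ii) $\sum_n(1-\kappa\gamma_n/\alpha)D_{f_n}(x_{n+1},x_n)<+\infty$ and $\sum_n(1-\kappa\gamma_n/\alpha)D_f(x_{n+1},x_n)<+\infty$. (iii) $\sum_n\langle x_{n+1}-z,\gamma_n^{-1}(\nabla f_n(x_n)-\nabla f_n(x_{n+1}))-Bx_n+Bz\rangle<+\infty$. (iv) $\sum_n(1-\delta_2)\langle x_n-z,Bx_n-Bz\rangle<+\infty$. (All these series converge absolutely.) Moreover: (v) $(x_n)_{n\in\mathbb N}$ is bounded if one of the following holds: [a] $C$ is bounded; [b] $f$ is supercoercive; [c] $f$ is uniformly convex; [d] $f$ is essentially strictly convex, $\operatorname{dom} f^*$ is open and $\nabla f^*$ is weakly sequentially continuous; [e] $X$ is finite-dimensional and $\operatorname{dom} f^*$ is open; [f] $f$ is essentially strictly convex and $$\rho=\inf_{x,y\in\operatorname{int}\operatorname{dom} f,\ x\neq y}\frac{D_f(x,y)}{D_f(y,x)}\in\,]0,+\infty[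 .$$ -/

import Mathlib

open Filter Topology Set
open scoped Pointwise

noncomputable section

namespace BregmanFB

/-! ### Set-valued operators from a normed space to its dual -/

section Operators

variable {X : Type*} [NormedAddCommGroup X] [NormedSpace ℝ X]

/-- `X` is reflexive: the canonical embedding into the bidual is onto. -/
def IsReflexiveSpace (X : Type*) [NormedAddCommGroup X] [NormedSpace ℝ X] : Prop :=
  Function.Surjective (NormedSpace.inclusionInDoubleDual ℝ X)

/-- The domain of a set-valued operator. -/
def opDom (M : X → Set (StrongDual ℝ X)) : Set X := {x | (M x).Nonempty}

/-- The range of a set-valued operator. -/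
def opRan (M : X → Set (StrongDual ℝ X)) : Set (StrongDual ℝ X) := {u | ∃ x, u ∈ M x}

/-- The zeros of a set-valued operator. -/
def opZer (M : X → Set (StrongDual ℝ X)) : Set X := {x | 0 ∈ M x}

/-- The inverse of a set-valued operator. -/
def opInv (M : X → Set (StrongDual ℝ X)) : StrongDual ℝ X → Set X := fun u => {x | u ∈ M x}

/-- Monotonicity of a set-valued operator. -/
def IsMonotoneOp (M : X → Set (StrongDual ℝ X)) : Prop :=
  ∀ x₁ x₂ : X, ∀ u₁ ∈ M x₁, ∀ u₂ ∈ M x₂, 0 ≤ (u₁ - u₂) (x₁ - x₂)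

/-- Maximal monotonicity; the order on `X → Set (StrongDual ℝ X)` is inclusion of graphs. -/
def IsMaximallyMonotone (M : X → Set (StrongDual ℝ X)) : Prop :=
  Maximal IsMonotoneOp M

/-- The value of an operator at a point where it is single-valued
(an arbitrary value, or `0`, at other points). -/
def val (M : X → Set (StrongDual ℝ X)) (x : X) : StrongDual ℝ X :=
  open Classical in if h : (M x).Nonempty then h.some else 0

/-- Every point of the domain has a neighborhood with bounded image. -/
def IsLocallyBoundedOnDom (M : X → Set (StrongDual ℝ X)) : Prop :=
  ∀ x ∈ opDom M, ∃ U ∈ 𝓝 x, Bornology.IsBounded (⋃ y ∈ U, M y)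

/-- The operator takes exactly one value at each point of its domain. -/
def IsSingleValuedOnDom (M : X → Set (StrongDual ℝ X)) : Prop :=
  ∀ x ∈ opDom M, ∃! u, u ∈ M x

end Operators

/-! ### Convex analysis -/

section Functions

variable {X : Type*} [NormedAddCommGroup X] [NormedSpace ℝ X]

/-- The (effective) domain of an extended-real-valued function. -/
def fdom (f : X → EReal) : Set X := {x | f x < ⊤}

/-- `Γ₀(X)`: proper lower semicontinuous convex functions with values in `]-∞, +∞]`. -/
structure IsGamma0 (f : X → EReal) : Prop where
  ne_bot : ∀ x, f x ≠ ⊥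
  proper : (fdom f).Nonempty
  lsc : LowerSemicontinuous f
  convex : ∀ x y : X, ∀ a b : ℝ, 0 < a → 0 < b → a + b = 1 →
    f (a • x + b • y) ≤ (a : EReal) * f x + (b : EReal) * f y

/-- The conjugate function on the dual space. -/
def conj (f : X → EReal) : StrongDual ℝ X → EReal :=
  fun u => ⨆ x : X, ((u x : ℝ) : EReal) - f x

/-- The subdifferential. -/
def subdiff (f : X → EReal) : X → Set (StrongDual ℝ X) :=
  fun x => {u | ∀ y : X, ((u (y - x) : ℝ) : EReal) + f x ≤ f y}

/-- The Gâteaux gradient of `f`, as an operator with at most one value at each point and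
defined only on the interior of the domain of `f` (near such a point, `f` is finite). -/
def gradOp (f : X → EReal) : X → Set (StrongDual ℝ X) :=
  fun x => {u | x ∈ interior (fdom f) ∧
    ∀ h : X, HasLineDerivAt ℝ (fun y => (f y).toReal) (u h) x h}

/-- The Gâteaux gradient as a function. -/
def grad (f : X → EReal) : X → StrongDual ℝ X := val (gradOp f)

/-- `f` is Gâteaux differentiable at each point of `s` (with `s` inside `int dom f`). -/
def IsGateauxDiffOn (f : X → EReal) (s : Set X) : Prop := s ⊆ opDom (gradOp f)

/-- The Bregman distance `D_f`. -/
def breg (f : X → EReal) (x y : X) : EReal :=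
  open Classical in
  if y ∈ interior (fdom f) then f x - f y - ((grad f y (x - y) : ℝ) : EReal) else ⊤

/-- The class `𝒞_α(f)`. -/
structure IsInCalpha (α : ℝ) (f g : X → EReal) : Prop where
  gamma0 : IsGamma0 g
  dom_eq : fdom g = fdom f
  gateaux : IsGateauxDiffOn g (interior (fdom f))
  breg_ge : ∀ x y : X, (α : EReal) * breg f x y ≤ breg g x y

/-- Essential smoothness. -/
def IsEssSmooth (f : X → EReal) : Prop :=
  IsLocallyBoundedOnDom (subdiff f) ∧ IsSingleValuedOnDom (subdiff f)

/-- Essential strict convexity (`f` is finite on `dom ∂f`). -/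
def IsEssStrictlyConvex (f : X → EReal) : Prop :=
  IsLocallyBoundedOnDom (subdiff (conj f)) ∧
    ∀ s : Set X, s ⊆ opDom (subdiff f) → Convex ℝ s →
      StrictConvexOn ℝ s (fun x => (f x).toReal)

/-- Supercoercivity: `f(x)/‖x‖ → +∞` as `‖x‖ → +∞`. -/
def IsSupercoercive (f : X → EReal) : Prop :=
  Tendsto (fun x => f x / ((‖x‖ : ℝ) : EReal)) (Bornology.cobounded X) (𝓝 ⊤)

/-- Uniform convexity: there is a modulus that vanishes only at `0`. -/
def IsUniformlyConvex (f : X → EReal) : Prop :=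
  ∃ φ : ℝ → ℝ, φ 0 = 0 ∧ (∀ t, 0 < t → 0 < φ t) ∧
    UniformConvexOn (fdom f) φ (fun x => (f x).toReal)

/-- Weak convergence of a sequence in a normed space. -/
def WeakTendsto (u : ℕ → X) (l : X) : Prop :=
  ∀ v : StrongDual ℝ X, Tendsto (fun n => v (u n)) atTop (𝓝 (v l))

/-- Weak sequential continuity of a map on a set. -/
def IsWeaklySeqContinuousOn {Y : Type*} [NormedAddCommGroup Y] [NormedSpace ℝ Y]
    (G : X → Y) (s : Set X) : Prop :=
  ∀ (u : ℕ → X) (l : X), (∀ n, u n ∈ s) → l ∈ s → WeakTendsto u l →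
    WeakTendsto (fun n => G (u n)) (G l)

/-- The infimum of `D_f(x,y)/D_f(y,x)` over distinct `x`, `y` in `int dom f`. -/
def symRatio (f : X → EReal) : EReal :=
  ⨅ x ∈ interior (fdom f), ⨅ y ∈ interior (fdom f), ⨅ _ : x ≠ y, breg f x y / breg f y x

/-- `∑ aₙ < +∞` for a sequence of extended reals: all terms are finite, and their real values
form a summable sequence. -/
def HasFiniteSum (a : ℕ → EReal) : Prop :=
  ∃ s : ℕ → ℝ, (∀ n, a n = (s n : EReal)) ∧ Summable s

end Functions

/-! ### The problem and the algorithm -/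

section Algorithm

variable {X : Type*} [NormedAddCommGroup X] [NormedSpace ℝ X]

/-- `C = (int dom f) ∩ dom A`. -/
def setC (f : X → EReal) (A : X → Set (StrongDual ℝ X)) : Set X :=
  interior (fdom f) ∩ opDom A

/-- `𝒮 = (int dom f) ∩ zer (A + B)`. -/
def setS (f : X → EReal) (A B : X → Set (StrongDual ℝ X)) : Set X :=
  interior (fdom f) ∩ opZer (A + B)

/-- The forward operator `∇g - γ B`. -/
def forwardOp (g : X → EReal) (γ : ℝ) (B : X → Set (StrongDual ℝ X)) :
    X → Set (StrongDual ℝ X) :=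
  gradOp g - γ • B

/-- The operator `∇g + γ A`, whose inverse is the backward operator. -/
def backwardOp (g : X → EReal) (γ : ℝ) (A : X → Set (StrongDual ℝ X)) :
    X → Set (StrongDual ℝ X) :=
  gradOp g + γ • A

/-- `x` starts at `x₀` and satisfies `xₙ₊₁ ∈ (∇fₙ + γₙ A)⁻¹ ((∇fₙ - γₙ B) xₙ)` for all `n`. -/
def IsGenerated (A B : X → Set (StrongDual ℝ X)) (fs : ℕ → X → EReal) (γ : ℕ → ℝ)
    (x₀ : X) (x : ℕ → X) : Prop :=
  x 0 = x₀ ∧ ∀ n, ∃ w ∈ forwardOp (fs n) (γ n) B (x n),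
    x (n + 1) ∈ opInv (backwardOp (fs n) (γ n) A) w

end Algorithm

end BregmanFB

end

open BregmanFB

/-! A backward step has at most one solution, because two of them would make the monotonicity of `A`
contradict the strict monotonicity of `∇fₙ` on `C`; the range condition provides one.

The convergence statements come from a Lyapunov argument. Fix `z ∈ 𝒮`, so that `-Bz ∈ Az`. Let `xₙ*
∈ A xₙ` be the element produced by the previous step (any element for `n = 0`), `Tₙ = ⟨xₙ - z, xₙ* +
Bz⟩ ≥ 0` and `bₙ = ⟨xₙ - z, Bxₙ - Bz⟩ ≥ 0`. The three-point identity for `D_{fₙ}`, the standing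
inequality at `(xₙ₊₁, xₙ, z)` and `α D_f ≤ D_{fₙ}` bound `D_{fₙ₊₁}(z, xₙ₊₁)` by `1 + ηₙ` times
`D_{fₙ}(z, xₙ) - (1 - κγₙ/α) D_{fₙ}(xₙ₊₁, xₙ) + γₙδ₁Tₙ - γₙ(1 - δ₂)bₙ - γₙTₙ₊₁`. As `δ₁γₙ₊₁/γₙ ≤ q <
1`, the quantity `D_{fₙ₊₁}(z, xₙ₊₁) + γₙTₙ₊₁` decreases up to a summable relative error, so it
converges and all the subtracted terms are summable (`tendsto_and_summable_of_forwardBackward`).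

For boundedness, `D_f(z, xₙ)` is bounded. Since `z` is interior to `dom f`, the gradients `∇f(xₙ)`
are then bounded, and so is `f*` along them. Each case returns from gradients or Bregman distances
to points: by growth of `f`, by regularity of `f*` at a limit of the gradients, or by exchanging the
arguments of `D_f`. -/

namespace BregmanFB

/-! ### Subgradients, continuity and Gâteaux differentiability in `Γ₀(X)`. -/

section ConvexAnalysis

variable {X : Type*} [NormedAddCommGroup X] [NormedSpace ℝ X] {f : X → EReal}

lemma IsGamma0.coe_toReal (hf : IsGamma0 f) {x : X} (hx : x ∈ fdom f) :
    ((f x).toReal : EReal) = f x :=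
  EReal.coe_toReal (ne_of_lt hx) (hf.ne_bot x)

lemma IsGamma0.convexOn_toReal (hf : IsGamma0 f) :
    ConvexOn ℝ (fdom f) (fun x => (f x).toReal) := by
  have key : ∀ x ∈ fdom f, ∀ y ∈ fdom f, ∀ a b : ℝ, 0 < a → 0 < b → a + b = 1 →
      f (a • x + b • y) ≤ ((a * (f x).toReal + b * (f y).toReal : ℝ) : EReal) := by
    intro x hx y hy a b ha hb hab
    have h := hf.convex x y a b ha hb hab
    rw [← hf.coe_toReal hx, ← hf.coe_toReal hy] at h
    exact_mod_cast h
  have hconv : Convex ℝ (fdom f) := by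
    rw [convex_iff_forall_pos]
    intro x hx y hy a b ha hb hab
    exact (key x hx y hy a b ha hb hab).trans_lt (EReal.coe_lt_top _)
  rw [convexOn_iff_forall_pos]
  refine ⟨hconv, fun x hx y hy a b ha hb hab => ?_⟩
  have h := key x hx y hy a b ha hb hab
  rw [← hf.coe_toReal (hconv hx hy ha.le hb.le hab)] at h
  exact_mod_cast h

lemma IsGamma0.le_coe_iff (hf : IsGamma0 f) {x : X} {t : ℝ} :
    f x ≤ t ↔ x ∈ fdom f ∧ (f x).toReal ≤ t := by
  constructor
  · intro h
    have hx : x ∈ fdom f := h.trans_lt (EReal.coe_lt_top t)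
    refine ⟨hx, ?_⟩
    rw [← hf.coe_toReal hx] at h
    exact_mod_cast h
  · rintro ⟨hx, h⟩
    rw [← hf.coe_toReal hx]
    exact_mod_cast h

lemma IsGamma0.mem_fdom_of_mem_subdiff (hf : IsGamma0 f) {x : X} {u : StrongDual ℝ X}
    (hu : u ∈ subdiff f x) : x ∈ fdom f := by
  obtain ⟨y, hy⟩ := hf.proper
  have h := hu y
  by_contra hx
  have hx' : f x = ⊤ := not_lt_top_iff.1 hx
  rw [hx', EReal.coe_add_top] at h
  exact (lt_of_lt_of_le hy h).ne rfl

lemma IsGamma0.mem_subdiff_iff (hf : IsGamma0 f) {x : X} {u : StrongDual ℝ X}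
    (hx : x ∈ fdom f) :
    u ∈ subdiff f x ↔ ∀ y ∈ fdom f, u (y - x) + (f x).toReal ≤ (f y).toReal := by
  constructor
  · intro hu y hy
    have h := hu y
    rw [← hf.coe_toReal hx, ← hf.coe_toReal hy] at h
    exact_mod_cast h
  · intro h y
    by_cases hy : y ∈ fdom f
    · have := h y hy
      rw [← hf.coe_toReal hx, ← hf.coe_toReal hy]
      exact_mod_cast this
    · rw [show f y = ⊤ from not_lt_top_iff.1 hy]
      exact le_top

/-- A subgradient inequality on the interior of the domain extends to the whole space. -/
lemma IsGamma0.mem_subdiff_of_interior (hf : IsGamma0 f) {x : X} {u : StrongDual ℝ X}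
    (hx : x ∈ interior (fdom f))
    (h : ∀ y ∈ interior (fdom f), u (y - x) + (f x).toReal ≤ (f y).toReal) :
    u ∈ subdiff f x := by
  rw [hf.mem_subdiff_iff (interior_subset hx)]
  intro y hy
  have hc := hf.convexOn_toReal
  -- The midpoint of `x` and `y` is interior, so `h` applies there; convexity carries the inequality
  -- on to `y`.
  have hm := hc.1.combo_interior_self_mem_interior hx hy (a := 1 / 2) (b := 1 / 2)
    (by norm_num) (by norm_num) (by norm_num)
  have h1 := h _ hm
  have h2 := hc.2 (interior_subset hx) hy (show (0 : ℝ) ≤ 1 / 2 by norm_num)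
    (show (0 : ℝ) ≤ 1 / 2 by norm_num) (by norm_num)
  have h3 : ((1 / 2 : ℝ) • x + (1 / 2 : ℝ) • y) - x = (1 / 2 : ℝ) • (y - x) := by module
  rw [h3, map_smul] at h1
  simp only [smul_eq_mul] at h1 h2
  linarith

lemma gradOp_subsingleton (f : X → EReal) (x : X) : (gradOp f x).Subsingleton := by
  intro u hu v hv
  ext h
  exact (hu.2 h).unique (hv.2 h)

lemma val_eq_of_subsingleton {M : X → Set (StrongDual ℝ X)} {x : X} {u : StrongDual ℝ X}
    (hs : (M x).Subsingleton) (hu : u ∈ M x) : val M x = u := by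
  have hne : (M x).Nonempty := ⟨u, hu⟩
  rw [val, dif_pos hne]
  exact hs hne.some_mem hu

lemma val_mem {M : X → Set (StrongDual ℝ X)} {x : X} (hx : x ∈ opDom M) : val M x ∈ M x := by
  have hne : (M x).Nonempty := hx
  rw [val, dif_pos hne]
  exact hne.some_mem

lemma grad_eq {x : X} {u : StrongDual ℝ X} (hu : u ∈ gradOp f x) : grad f x = u :=
  val_eq_of_subsingleton (gradOp_subsingleton f x) hu

lemma IsGamma0.gradOp_subset_subdiff (hf : IsGamma0 f) (x : X) : gradOp f x ⊆ subdiff f x := by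
  rintro u ⟨hx, hu⟩
  rw [hf.mem_subdiff_iff (interior_subset hx)]
  intro y hy
  have hlim := (hu (y - x)).tendsto_slope_zero_right
  have hle : ∀ᶠ t : ℝ in 𝓝[>] 0,
      t⁻¹ • ((f (x + t • (y - x))).toReal - (f x).toReal) ≤ (f y).toReal - (f x).toReal := by
    filter_upwards [Ioo_mem_nhdsGT (zero_lt_one (α := ℝ))] with t ht
    have h2 := hf.convexOn_toReal.2 (interior_subset hx) hy
      (show 0 ≤ 1 - t by linarith [ht.2]) ht.1.le (by ring)
    have h3 : (1 - t) • x + t • y = x + t • (y - x) := by module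
    rw [h3] at h2
    simp only [smul_eq_mul] at h2 ⊢
    rw [inv_mul_le_iff₀ ht.1]
    linarith
  have := le_of_tendsto hlim hle
  linarith

/-- A lower semicontinuous convex function on a Banach space is locally bounded above on the
interior of its domain. -/
lemma IsGamma0.isBoundedUnder [CompleteSpace X] (hf : IsGamma0 f) {x : X}
    (hx : x ∈ interior (fdom f)) :
    (𝓝 x).IsBoundedUnder (· ≤ ·) (fun y => (f y).toReal) := by
  have hc : ConvexOn ℝ (interior (fdom f)) (fun y => (f y).toReal) :=
    hf.convexOn_toReal.subset interior_subset hf.convexOn_toReal.1.interior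
  suffices h : ∃ x₀ ∈ interior (fdom f),
      (𝓝 x₀).IsBoundedUnder (· ≤ ·) (fun y => (f y).toReal) by
    have h' : ∀ ⦃x₀⦄, x₀ ∈ interior (fdom f) →
        (𝓝 x₀).IsBoundedUnder (· ≤ ·) (fun y => (f y).toReal) :=
      ((hc.continuousOn_tfae isOpen_interior ⟨x, hx⟩).out 3 4).mp h
    exact h' hx
  -- Baire category: adjoining the closed complement of the interior makes these closed sets cover
  -- the whole space, so one of them has interior meeting `interior (fdom f)`.
  let S : ℕ → Set X := fun n => {y | f y ≤ ((n : ℝ) : EReal)} ∪ (interior (fdom f))ᶜ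
  have hS : ∀ n, IsClosed (S n) := fun n =>
    (hf.lsc.isClosed_preimage _).union isOpen_interior.isClosed_compl
  have hU : ⋃ n, S n = univ := by
    refine eq_univ_of_forall fun y => mem_iUnion.2 ?_
    by_cases hy : y ∈ interior (fdom f)
    · obtain ⟨n, hn⟩ := exists_nat_ge (f y).toReal
      exact ⟨n, Or.inl (hf.le_coe_iff.2 ⟨interior_subset hy, hn⟩)⟩
    · exact ⟨0, Or.inr hy⟩
  obtain ⟨y, hyU, hy⟩ := (dense_iUnion_interior_of_closed hS hU).exists_mem_open
    isOpen_interior ⟨x, hx⟩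
  obtain ⟨n, hn⟩ := mem_iUnion.1 hyU
  refine ⟨y, hy, n, ?_⟩
  rw [eventually_map]
  filter_upwards [isOpen_interior.mem_nhds hn, isOpen_interior.mem_nhds hy] with w hw hw'
  rcases interior_subset hw with h | h
  · exact (hf.le_coe_iff.1 h).2
  · exact absurd hw' h

lemma IsGamma0.exists_forall_closedBall_le [CompleteSpace X] (hf : IsGamma0 f) {x : X}
    (hx : x ∈ interior (fdom f)) :
    ∃ r > 0, ∃ M : ℝ, ∀ y ∈ Metric.closedBall x r, y ∈ fdom f ∧ (f y).toReal ≤ M := by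
  obtain ⟨M, hM⟩ := hf.isBoundedUnder hx
  rw [eventually_map] at hM
  obtain ⟨r, hr, h⟩ := Metric.nhds_basis_closedBall.mem_iff.1
    (hM.and (mem_interior_iff_mem_nhds.1 hx))
  exact ⟨r, hr, M, fun y hy => ⟨(h hy).2, (h hy).1⟩⟩

lemma IsGamma0.continuousOn_interior [CompleteSpace X] (hf : IsGamma0 f) :
    ContinuousOn (fun y => (f y).toReal) (interior (fdom f)) := by
  rcases (interior (fdom f)).eq_empty_or_nonempty with h | ⟨x, hx⟩
  · rw [h]
    exact continuousOn_empty _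
  have hc : ConvexOn ℝ (interior (fdom f)) (fun y => (f y).toReal) :=
    hf.convexOn_toReal.subset interior_subset hf.convexOn_toReal.1.interior
  refine ((hc.continuousOn_tfae isOpen_interior ⟨x, hx⟩).out 3 1).mp ?_
  exact ⟨x, hx, hf.isBoundedUnder hx⟩

/-- Every line that supports the graph of `f` at an interior point of the domain extends to a
supporting hyperplane. -/
lemma IsGamma0.exists_mem_subdiff_apply_eq [CompleteSpace X] (hf : IsGamma0 f) {x h : X} {s : ℝ}
    (hx : x ∈ interior (fdom f))
    (hs : ∀ t : ℝ, x + t • h ∈ fdom f → (f x).toReal + t * s ≤ (f (x + t • h)).toReal) :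
    ∃ u ∈ subdiff f x, u h = s := by
  set F : X → ℝ := fun y => (f y).toReal with hF
  have hc : ConvexOn ℝ (interior (fdom f)) F :=
    hf.convexOn_toReal.subset interior_subset hf.convexOn_toReal.1.interior
  let E : Set (X × ℝ) := {p | p.1 ∈ interior (fdom f) ∧ F p.1 < p.2}
  have hEo : IsOpen E := by
    have hcont : ContinuousOn (fun p : X × ℝ => p.2 - F p.1)
        (Prod.fst ⁻¹' interior (fdom f)) :=
      continuousOn_snd.sub (hf.continuousOn_interior.comp continuousOn_fst fun p hp => hp)
    have := hcont.isOpen_inter_preimage (isOpen_interior.preimage continuous_fst)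
      (isOpen_Ioi (a := (0 : ℝ)))
    convert! this using 1
    ext p
    simp [E]
  let L : Set (X × ℝ) := range fun t : ℝ => (x + t • h, F x + t * s)
  have hL : Convex ℝ L := by
    rintro _ ⟨t, rfl⟩ _ ⟨t', rfl⟩ a b _ _ hab
    refine ⟨a * t + b * t', ?_⟩
    ext1
    · calc x + (a * t + b * t') • h = (a + b) • x + (a * t + b * t') • h := by
            rw [hab, one_smul]
        _ = a • (x + t • h) + b • (x + t' • h) := by module
    · calc F x + (a * t + b * t') * s = (a + b) * F x + (a * t + b * t') * s := by
            rw [hab, one_mul]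
        _ = a • (F x + t * s) + b • (F x + t' * s) := by simp only [smul_eq_mul]; ring
  have hdisj : Disjoint E L := by
    rw [Set.disjoint_left]
    rintro _ hp ⟨t, rfl⟩
    have h1 := hs t (interior_subset hp.1)
    have h2 := hp.2
    simp only [hF] at h2
    linarith
  -- The open strict epigraph is separated from the supporting line. The vertical component `b` of
  -- the functional is negative, and `-b` normalizes the slope.
  obtain ⟨g, c, hg, hg'⟩ := geometric_hahn_banach_open hc.convex_strict_epigraph hEo hL hdisj
  have hsplit : ∀ y t, g (y, t) = g (y, 0) + t * g (0, 1) := by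
    intro y t
    have : ((y, t) : X × ℝ) = (y, 0) + t • (0, 1) := by ext1 <;> simp
    rw [this, map_add, map_smul, smul_eq_mul]
  set b := g (0, 1) with hb
  have hx0 : c ≤ g (x, 0) + F x * b := by
    have := hg' _ ⟨0, rfl⟩
    simpa [hsplit x (F x)] using this
  have hbneg : b < 0 := by
    have h1 : g (x, F x + 1) < c := hg _ ⟨hx, by simp⟩
    rw [hsplit] at h1
    linarith
  -- Along the line, `g` is affine in the parameter and bounded below, hence constant.
  have hline : g (h, 0) + s * b = 0 := by
    by_contra hne
    set d := g (h, 0) + s * b with hd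
    have h1 : ∀ t : ℝ, c ≤ g (x, 0) + F x * b + t * d := by
      intro t
      have h2 := hg' _ ⟨t, rfl⟩
      simp only at h2
      have : g (x + t • h, 0) = g (x, 0) + t * g (h, 0) := by
        have : ((x + t • h, 0) : X × ℝ) = (x, 0) + t • (h, 0) := by ext1 <;> simp
        rw [this, map_add, map_smul, smul_eq_mul]
      rw [hsplit, this] at h2
      rw [hd]
      linarith
    have h2 := h1 ((c - 1 - (g (x, 0) + F x * b)) / d)
    rw [div_mul_cancel₀ _ hne] at h2
    linarith
  have hU : ∀ y ∈ interior (fdom f), g (y, 0) + F y * b ≤ c := by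
    intro y hy
    refine le_of_forall_pos_le_add fun ε hε => ?_
    have hpos : 0 < ε / (-b) := div_pos hε (by linarith)
    have h1 : g (y, F y + ε / (-b)) < c := hg _ ⟨hy, by simpa using hpos⟩
    rw [hsplit, add_mul] at h1
    have : ε / (-b) * b = -ε := by
      rw [div_neg, neg_mul, div_mul_cancel₀ _ hbneg.ne]
    linarith
  let u : StrongDual ℝ X := (-b)⁻¹ • g.comp (ContinuousLinearMap.inl ℝ X ℝ)
  have hu : ∀ y, u y = (-b)⁻¹ * g (y, 0) := fun y => by simp [u]
  refine ⟨u, hf.mem_subdiff_of_interior hx fun y hy => ?_, ?_⟩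
  · have h1 : g (y - x, 0) = g (y, 0) - g (x, 0) := by
      rw [← map_sub]
      simp
    rw [hu, h1, ← le_sub_iff_add_le, inv_mul_le_iff₀ (by linarith)]
    have := hU y hy
    simp only [hF] at this hx0
    linarith
  · rw [hu, inv_mul_eq_iff_eq_mul₀ (by linarith)]
    linarith

/-- A lower semicontinuous convex function on a Banach space is Gâteaux differentiable at the
interior points of its domain at which it has at most one subgradient. -/
lemma IsGamma0.exists_mem_gradOp [CompleteSpace X] (hf : IsGamma0 f) {x : X}
    (hx : x ∈ interior (fdom f)) (hs : (subdiff f x).Subsingleton) : ∃ u, u ∈ gradOp f x := by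
  have hne : ∃ u ∈ subdiff f x, u (0 : X) = 0 := by
    refine hf.exists_mem_subdiff_apply_eq hx fun t _ => ?_
    simp
  obtain ⟨u, hu, -⟩ := hne
  refine ⟨u, hx, fun h => ?_⟩
  let ℓ : ℝ →ᵃ[ℝ] X := AffineMap.lineMap x (x + h)
  have hℓ : ∀ t, ℓ t = x + t • h := fun t => by
    simp [ℓ, AffineMap.lineMap_apply, add_comm]
  let S : Set ℝ := ℓ ⁻¹' fdom f
  set φ : ℝ → ℝ := fun t => (f (x + t • h)).toReal with hφ
  have hφc : ConvexOn ℝ S φ := by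
    have hcomp : φ = (fun x => (f x).toReal) ∘ ℓ := by
      ext t
      simp [hφ, hℓ]
    rw [hcomp]
    exact hf.convexOn_toReal.comp_affineMap ℓ
  have hcont : Continuous fun t : ℝ => x + t • h := by fun_prop
  have h0 : (0 : ℝ) ∈ interior S := by
    have hS : S = (fun t : ℝ => x + t • h) ⁻¹' fdom f := by
      ext t
      simp [S, hℓ]
    rw [hS, mem_interior_iff_mem_nhds]
    refine hcont.continuousAt.preimage_mem_nhds ?_
    simpa using mem_interior_iff_mem_nhds.1 hx
  have hr := hφc.hasDerivWithinAt_rightDeriv_of_mem_interior h0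
  have hl := hφc.hasDerivWithinAt_leftDeriv_of_mem_interior h0
  set r := derivWithin φ (Ioi 0) 0
  set l := derivWithin φ (Iio 0) 0
  have hlr : l ≤ r := hφc.leftDeriv_le_rightDeriv_of_mem_interior h0
  have hφ0 : φ 0 = (f x).toReal := by simp [hφ]
  -- Every slope between the two one-sided derivatives is the value at `h` of a subgradient;
  -- uniqueness of the subgradient forces `l = r`.
  have hsup : ∀ s ∈ Icc l r, ∃ v ∈ subdiff f x, v h = s := by
    intro s hs
    refine hf.exists_mem_subdiff_apply_eq hx fun t ht => ?_
    change (f x).toReal + t * s ≤ φ t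
    have htS : t ∈ S := by simpa [S, hℓ] using ht
    rcases lt_trichotomy t 0 with h1 | rfl | h1
    · have h2 := hφc.slope_le_of_hasDerivWithinAt_Iio htS (interior_subset h0) h1 hl
      rw [slope_def_field, div_le_iff₀ (by linarith), hφ0] at h2
      nlinarith [hs.1]
    · simp [hφ0]
    · have h2 := hφc.le_slope_of_hasDerivWithinAt_Ioi (interior_subset h0) htS h1 hr
      rw [slope_def_field, le_div_iff₀ (by linarith), hφ0] at h2
      nlinarith [hs.2]
  obtain ⟨v, hv, hvl⟩ := hsup l ⟨le_rfl, hlr⟩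
  obtain ⟨w, hw, hwr⟩ := hsup r ⟨hlr, le_rfl⟩
  rw [hs hv hu] at hvl
  rw [hs hw hu] at hwr
  rw [← hvl] at hl
  rw [← hwr] at hr
  have := hl.Iic_of_Iio.union hr.Ici_of_Ioi
  rw [Iic_union_Ici, hasDerivWithinAt_univ] at this
  exact this

end ConvexAnalysis

/-! ### Almost decreasing real sequences. -/

section RealSequences

/-- Convergence of nonnegative sequences that decrease up to a summable relative error. -/
lemma tendsto_and_summable_of_le_one_add_mul_sub {a e η : ℕ → ℝ} (ha : ∀ n, 0 ≤ a n)
    (he : ∀ n, 0 ≤ e n) (hη : ∀ n, 0 ≤ η n) (hηs : Summable η)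
    (h : ∀ n, a (n + 1) ≤ (1 + η n) * a n - e n) :
    (∃ l : ℝ, Tendsto a atTop (𝓝 l)) ∧ Summable e := by
  -- Dividing by these partial products, which stay between `1` and `exp (∑ η)`, turns the recursion
  -- into a genuine decrease.
  let P : ℕ → ℝ := fun n => ∏ k ∈ Finset.range n, (1 + η k)
  have hPs : ∀ n, P (n + 1) = P n * (1 + η n) := fun n => Finset.prod_range_succ _ _
  have hP1 : ∀ n, 1 ≤ P n := by
    intro n
    induction n with
    | zero => simp [P]
    | succ n ih =>
      rw [hPs]
      nlinarith [hη n]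
  have hP0 : ∀ n, 0 < P n := fun n => one_pos.trans_le (hP1 n)
  have hPm : Monotone P := by
    refine monotone_nat_of_le_succ fun n => ?_
    rw [hPs]
    nlinarith [hη n, hP0 n]
  set K := Real.exp (∑' n, η n)
  have hPK : ∀ n, P n ≤ K := by
    intro n
    calc P n ≤ ∏ k ∈ Finset.range n, Real.exp (η k) :=
          Finset.prod_le_prod (fun k _ => by linarith [hη k])
            fun k _ => by linarith [Real.add_one_le_exp (η k)]
      _ = Real.exp (∑ k ∈ Finset.range n, η k) := (Real.exp_sum _ _).symm
      _ ≤ K := Real.exp_le_exp.2 (hηs.sum_le_tsum _ fun k _ => hη k)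
  have hK : 0 < K := Real.exp_pos _
  have hPt := tendsto_atTop_ciSup hPm ⟨K, by rintro _ ⟨n, rfl⟩; exact hPK n⟩
  let b : ℕ → ℝ := fun n => a n / P n
  have hb0 : ∀ n, 0 ≤ b n := fun n => div_nonneg (ha n) (hP0 n).le
  have hb : ∀ n, b (n + 1) ≤ b n - e n / P (n + 1) := by
    intro n
    have h1 : b n = (1 + η n) * a n / P (n + 1) := by
      have := hη n
      have := (hP0 n).ne'
      simp only [b, hPs]
      field_simp
    rw [h1, ← sub_div]
    exact div_le_div_of_nonneg_right (h n) (hP0 _).le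
  have hq : ∀ n, 0 ≤ e n / P (n + 1) := fun n => div_nonneg (he n) (hP0 _).le
  have hba : Antitone b := antitone_nat_of_succ_le fun n => by linarith [hb n, hq n]
  have hbt := tendsto_atTop_ciInf hba ⟨0, by rintro _ ⟨n, rfl⟩; exact hb0 n⟩
  constructor
  · refine ⟨_, (hbt.mul hPt).congr fun n => ?_⟩
    exact div_mul_cancel₀ _ (hP0 n).ne'
  · have hsum : Summable fun n => e n / P (n + 1) := by
      refine summable_of_sum_range_le hq (c := b 0) fun n => ?_
      have : ∑ k ∈ Finset.range n, e k / P (k + 1) ≤ b 0 - b n := by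
        induction n with
        | zero => simp
        | succ n ih =>
          rw [Finset.sum_range_succ]
          linarith [hb n]
      linarith [hb0 n]
    refine (hsum.mul_left K).of_nonneg_of_le he fun n => ?_
    rw [mul_div_assoc', le_div_iff₀ (hP0 _), mul_comm]
    exact mul_le_mul_of_nonneg_right (hPK _) (he n)

/-- The recursion satisfied by the Bregman distances to a solution along the iterates. -/
lemma tendsto_and_summable_of_forwardBackward {d e T b ω γ η : ℕ → ℝ} {δ₁ δ₂ q c : ℝ}
    (hd : ∀ n, 0 ≤ d n) (he : ∀ n, 0 ≤ e n) (hT : ∀ n, 0 ≤ T n) (hb : ∀ n, 0 ≤ b n)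
    (hω : ∀ n, 0 ≤ ω n) (hη : ∀ n, 0 ≤ η n) (hηs : Summable η) (hδ₂ : δ₂ ≤ 1)
    (hc : 0 < c) (hγ : ∀ n, c ≤ γ n) (hq : q < 1) (hδq : ∀ n, δ₁ * γ (n + 1) / γ n ≤ q)
    (h : ∀ n, d (n + 1) ≤ (1 + η n) *
      (d n - ω n * e n + γ n * (δ₁ * T n) - γ n * ((1 - δ₂) * b n) - γ n * T (n + 1))) :
    (∃ l : ℝ, Tendsto d atTop (𝓝 l)) ∧ Summable (fun n => ω n * e n) ∧
      Summable (fun n => T (n + 1)) ∧ Summable (fun n => (1 - δ₂) * b n) := by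
  have hγ0 : ∀ n, 0 < γ n := fun n => hc.trans_le (hγ n)
  -- Adding `γ n * T (n + 1)` to the distance absorbs the `δ₁` term of the next step and leaves the
  -- fraction `1 - q` in `ε`. The shift by one gives every `T` an earlier step size.
  let a : ℕ → ℝ := fun n => d (n + 1) + γ n * T (n + 1)
  let ε : ℕ → ℝ := fun n => ω (n + 1) * e (n + 1) + (1 - q) * (γ n * T (n + 1)) +
    γ (n + 1) * ((1 - δ₂) * b (n + 1))
  have hT' : ∀ n, 0 ≤ γ n * T (n + 1) := fun n => mul_nonneg (hγ0 n).le (hT _)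
  have h1 : ∀ n, 0 ≤ ω n * e n := fun n => mul_nonneg (hω n) (he n)
  have h2 : ∀ n, 0 ≤ (1 - q) * (γ n * T (n + 1)) := fun n =>
    mul_nonneg (by linarith) (hT' n)
  have h3 : ∀ n, 0 ≤ (1 - δ₂) * b n := fun n => mul_nonneg (by linarith) (hb n)
  have h3' : ∀ n, 0 ≤ γ n * ((1 - δ₂) * b n) := fun n => mul_nonneg (hγ0 n).le (h3 n)
  have hε : ∀ n, 0 ≤ ε n := fun n => by
    have := h1 (n + 1)
    have := h2 n
    have := h3' (n + 1)
    positivity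
  have hrec : ∀ n, a (n + 1) ≤ (1 + η (n + 1)) * a n - ε n := by
    intro n
    have h4 : γ (n + 1) * (δ₁ * T (n + 1)) ≤ q * (γ n * T (n + 1)) := by
      have := (div_le_iff₀ (hγ0 n)).1 (hδq n)
      nlinarith [mul_le_mul_of_nonneg_right this (hT (n + 1))]
    have h5 : (d (n + 1) - ω (n + 1) * e (n + 1) + γ (n + 1) * (δ₁ * T (n + 1)) -
        γ (n + 1) * ((1 - δ₂) * b (n + 1)) - γ (n + 1) * T (n + 1 + 1)) ≤
        a n - ε n - γ (n + 1) * T (n + 1 + 1) := by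
      simp only [a, ε]
      linarith
    have h6 := (h (n + 1)).trans
      (mul_le_mul_of_nonneg_left h5 (by linarith [hη (n + 1)] : 0 ≤ 1 + η (n + 1)))
    have h7 := mul_nonneg (hη (n + 1)) (hε n)
    have h8 := mul_nonneg (hη (n + 1)) (hT' (n + 1))
    change d (n + 1 + 1) + γ (n + 1) * T (n + 1 + 1) ≤ _
    nlinarith
  obtain ⟨⟨l, hl⟩, hs⟩ := tendsto_and_summable_of_le_one_add_mul_sub
    (fun n => add_nonneg (hd _) (hT' n)) hε (fun n => hη (n + 1))
    ((summable_nat_add_iff 1).2 hηs) hrec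
  have hsT : Summable fun n => γ n * T (n + 1) := by
    refine (hs.mul_left (1 - q)⁻¹).of_nonneg_of_le hT' fun n => ?_
    rw [le_inv_mul_iff₀ (by linarith)]
    simp only [ε]
    linarith [h1 (n + 1), h3' (n + 1)]
  refine ⟨⟨l, ?_⟩, ?_, ?_, ?_⟩
  · rw [← tendsto_add_atTop_iff_nat 1]
    have := hl.sub hsT.tendsto_atTop_zero
    rw [sub_zero] at this
    exact this.congr fun n => by simp
  · rw [← summable_nat_add_iff 1]
    refine hs.of_nonneg_of_le (fun n => h1 _) fun n => ?_
    simp only [ε]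
    linarith [h2 n, h3' (n + 1)]
  · refine (hsT.mul_left c⁻¹).of_nonneg_of_le (fun n => hT _) fun n => ?_
    rw [le_inv_mul_iff₀ hc]
    exact mul_le_mul_of_nonneg_right (hγ n) (hT _)
  · rw [← summable_nat_add_iff 1]
    refine (hs.mul_left c⁻¹).of_nonneg_of_le (fun n => h3 _) fun n => ?_
    rw [le_inv_mul_iff₀ hc]
    have := mul_le_mul_of_nonneg_right (hγ (n + 1)) (h3 (n + 1))
    simp only [ε]
    linarith [h2 n, h1 (n + 1)]

end RealSequences

/-! ### Real-valued Bregman distances. -/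

section Bregman

variable {X : Type*} [NormedAddCommGroup X] [NormedSpace ℝ X] {f g : X → EReal}

/-- The real-valued expression of the Bregman distance between points of the domain. -/
noncomputable def realBreg (f : X → EReal) (x y : X) : ℝ :=
  (f x).toReal - (f y).toReal - grad f y (x - y)

lemma IsGamma0.breg_eq (hf : IsGamma0 f) {x y : X} (hx : x ∈ fdom f)
    (hy : y ∈ interior (fdom f)) : breg f x y = (realBreg f x y : EReal) := by
  rw [breg, if_pos hy, ← hf.coe_toReal hx, ← hf.coe_toReal (interior_subset hy), realBreg]
  norm_cast

lemma IsGamma0.grad_mem_subdiff (hf : IsGamma0 f) {y : X} (hy : y ∈ opDom (gradOp f)) :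
    grad f y ∈ subdiff f y :=
  hf.gradOp_subset_subdiff y (val_mem hy)

lemma IsGamma0.realBreg_nonneg (hf : IsGamma0 f) {x y : X} (hx : x ∈ fdom f)
    (hy : y ∈ opDom (gradOp f)) : 0 ≤ realBreg f x y := by
  have hu := hf.grad_mem_subdiff hy
  have := (hf.mem_subdiff_iff (hf.mem_fdom_of_mem_subdiff hu)).1 hu x hx
  rw [realBreg]
  linarith

/-- The identity that turns the backward step, which controls a gradient difference paired with `y -
z`, into a decrease of the distance to `z`. -/
lemma realBreg_three_point (f : X → EReal) (x y z : X) :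
    realBreg f z y = realBreg f z x - realBreg f y x - (grad f x - grad f y) (y - z) := by
  simp only [realBreg, map_sub, sub_apply]
  ring

lemma IsGamma0.isGateauxDiffOn_interior [CompleteSpace X] (hf : IsGamma0 f)
    (hfs : IsSingleValuedOnDom (subdiff f)) : IsGateauxDiffOn f (interior (fdom f)) := by
  intro x hx
  refine hf.exists_mem_gradOp hx fun u hu v hv => ?_
  exact (hfs x ⟨u, hu⟩).unique hu hv

lemma IsInCalpha.mul_realBreg_le {α : ℝ} (hf : IsGamma0 f) (hg : IsInCalpha α f g) {x y : X}
    (hx : x ∈ fdom f) (hy : y ∈ interior (fdom f)) : α * realBreg f x y ≤ realBreg g x y := by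
  have h := hg.breg_ge x y
  rw [hf.breg_eq hx hy, hg.gamma0.breg_eq (hg.dom_eq ▸ hx) (hg.dom_eq ▸ hy)] at h
  exact_mod_cast h

end Bregman

/-! ### One forward-backward step and the generated sequence. -/

section Algorithm

variable {X : Type*} [NormedAddCommGroup X] [NormedSpace ℝ X] {f g : X → EReal}
  {A B : X → Set (StrongDual ℝ X)} {γ : ℝ}

lemma forwardOp_eq {p : X} (hg : p ∈ opDom (gradOp g)) (hB : ∃! u, u ∈ B p) :
    forwardOp g γ B p = {grad g p - γ • val B p} := by
  have h1 : gradOp g p = {grad g p} :=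
    (gradOp_subsingleton g p).eq_singleton_of_mem (val_mem hg)
  have h2 : B p = {val B p} := by
    obtain ⟨u, hu, hun⟩ := hB
    refine Set.Subsingleton.eq_singleton_of_mem (fun v hv w hw => ?_) (val_mem ⟨u, hu⟩)
    rw [hun v hv, hun w hw]
  change gradOp g p - γ • B p = _
  rw [h1, h2, smul_set_singleton, singleton_sub_singleton]

lemma mem_backwardOp_iff (hγ : 0 < γ) {q : X} {w : StrongDual ℝ X} :
    w ∈ backwardOp g γ A q ↔
      q ∈ opDom (gradOp g) ∧ γ⁻¹ • (w - grad g q) ∈ A q := by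
  change w ∈ gradOp g q + γ • A q ↔ _
  constructor
  · rintro ⟨u, hu, v, hv, rfl⟩
    refine ⟨⟨u, hu⟩, ?_⟩
    rw [grad_eq hu, add_sub_cancel_left]
    exact (mem_smul_set_iff_inv_smul_mem₀ hγ.ne' _ _).1 hv
  · rintro ⟨hq, hA⟩
    refine ⟨grad g q, val_mem hq, w - grad g q, ?_, add_sub_cancel _ _⟩
    exact (mem_smul_set_iff_inv_smul_mem₀ hγ.ne' _ _).2 hA

/-- One forward-backward step is uniquely defined on `C` and stays in `C`. -/
lemma forwardBackward_step {α : ℝ} (hγ : 0 < γ) (hA : IsMonotoneOp A) (hg : IsInCalpha α f g)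
    (hB : ∀ x ∈ setC f A, ∃! u, u ∈ B x)
    (hmono : ∀ x ∈ setC f A, ∀ y ∈ setC f A, x ≠ y → 0 < (grad g x - grad g y) (x - y))
    (hran : ∀ x ∈ setC f A, forwardOp g γ B x ⊆ opRan (backwardOp g γ A))
    {p : X} (hp : p ∈ setC f A) :
    ∃ q ∈ setC f A, forwardOp g γ B p = {grad g p - γ • val B p} ∧
      opInv (backwardOp g γ A) (grad g p - γ • val B p) = {q} := by
  have hfw := forwardOp_eq (γ := γ) (hg.gateaux hp.1) (hB p hp)
  have hC : ∀ {w q}, w ∈ backwardOp g γ A q → q ∈ setC f A := by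
    intro w q h
    rw [mem_backwardOp_iff hγ] at h
    obtain ⟨⟨u, hu⟩, h⟩ := h
    exact ⟨hg.dom_eq ▸ hu.1, ⟨_, h⟩⟩
  obtain ⟨q, hq⟩ := hran p hp (hfw ▸ mem_singleton _)
  refine ⟨q, hC hq, hfw, Set.Subsingleton.eq_singleton_of_mem ?_ hq⟩
  intro q₁ h₁ q₂ h₂
  by_contra hne
  have h := hmono q₁ (hC h₁) q₂ (hC h₂) hne
  have hm := hA q₁ q₂ _ ((mem_backwardOp_iff hγ).1 h₁).2 _ ((mem_backwardOp_iff hγ).1 h₂).2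
  -- The common forward value cancels, so monotonicity of `A` makes the pairing of `∇g` at `q₁`,
  -- `q₂` nonpositive.
  have e : (γ⁻¹ • (grad g p - γ • val B p - grad g q₁) -
      γ⁻¹ • (grad g p - γ • val B p - grad g q₂)) (q₁ - q₂) =
      -(γ⁻¹ * (grad g q₁ - grad g q₂) (q₁ - q₂)) := by
    simp only [sub_apply, smul_apply, smul_eq_mul]
    ring
  rw [e] at hm
  linarith [mul_pos (inv_pos.2 hγ) h]

lemma existsUnique_isGenerated {fs : ℕ → X → EReal} {γ : ℕ → ℝ} {C : Set X} {x₀ : X}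
    (hx₀ : x₀ ∈ C)
    (h : ∀ n, ∀ p ∈ C, ∃ w, ∃ q ∈ C, forwardOp (fs n) (γ n) B p = {w} ∧
      opInv (backwardOp (fs n) (γ n) A) w = {q}) :
    ∃! x : ℕ → X, IsGenerated A B fs γ x₀ x := by
  choose w q hq hw hinv using h
  -- The recursion runs in the subtype because the next point is only defined on `C`.
  let s : ℕ → {p // p ∈ C} := fun n =>
    Nat.rec ⟨x₀, hx₀⟩ (fun n p => ⟨q n p.1 p.2, hq n p.1 p.2⟩) n
  refine ⟨fun n => (s n).1, ⟨rfl, fun n => ⟨w n (s n).1 (s n).2, ?_, ?_⟩⟩, ?_⟩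
  · rw [hw]
    exact mem_singleton _
  · rw [hinv]
    exact mem_singleton _
  · rintro y ⟨hy0, hy⟩
    funext n
    induction n with
    | zero => exact hy0
    | succ n ih =>
      obtain ⟨v, hv, hy'⟩ := hy n
      rw [ih, hw n _ (s n).2, mem_singleton_iff] at hv
      rw [hv, hinv, mem_singleton_iff] at hy'
      exact hy'

end Algorithm

/-! ### The conjugate and its subdifferential. -/

section Conjugate

variable {X : Type*} [NormedAddCommGroup X] [NormedSpace ℝ X] {f : X → EReal}

lemma IsGamma0.conj_le_iff (hf : IsGamma0 f) {u : StrongDual ℝ X} {c : ℝ} :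
    conj f u ≤ c ↔ ∀ x ∈ fdom f, u x - (f x).toReal ≤ c := by
  rw [conj, iSup_le_iff]
  refine forall_congr' fun x => ?_
  by_cases hx : x ∈ fdom f
  · rw [← hf.coe_toReal hx]
    simp only [hx, forall_const]
    norm_cast
  · rw [show f x = ⊤ from not_lt_top_iff.1 hx]
    simp [hx]

lemma IsGamma0.sub_le_conj (hf : IsGamma0 f) {x : X} (hx : x ∈ fdom f) (u : StrongDual ℝ X) :
    ((u x - (f x).toReal : ℝ) : EReal) ≤ conj f u := by
  have h : ((u x : ℝ) : EReal) - f x ≤ conj f u :=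
    le_iSup (fun x : X => ((u x : ℝ) : EReal) - f x) x
  rw [← hf.coe_toReal hx] at h
  exact_mod_cast h

lemma IsGamma0.conj_ne_bot (hf : IsGamma0 f) (u : StrongDual ℝ X) : conj f u ≠ ⊥ := by
  obtain ⟨x, hx⟩ := hf.proper
  exact ne_of_gt ((EReal.bot_lt_coe _).trans_le (hf.sub_le_conj hx u))

lemma IsGamma0.lowerSemicontinuous_conj (hf : IsGamma0 f) : LowerSemicontinuous (conj f) := by
  refine lowerSemicontinuous_iSup fun x => ?_
  by_cases hx : x ∈ fdom f
  · rw [← hf.coe_toReal hx]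
    simp_rw [← EReal.coe_sub]
    have : Continuous fun u : StrongDual ℝ X => ((u x - (f x).toReal : ℝ) : EReal) :=
      continuous_coe_real_ereal.comp (by fun_prop)
    exact this.lowerSemicontinuous
  · rw [show f x = ⊤ from not_lt_top_iff.1 hx]
    simp only [EReal.sub_top]
    exact lowerSemicontinuous_const

/-- Makes the continuity and differentiability results above available for the conjugate on the dual
space. -/
lemma IsGamma0.isGamma0_conj (hf : IsGamma0 f) (hne : (fdom (conj f)).Nonempty) :
    IsGamma0 (conj f) where
  ne_bot := hf.conj_ne_bot
  proper := hne
  lsc := hf.lowerSemicontinuous_conj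
  convex := by
    intro u v a b ha hb hab
    have hne : ∀ (w : StrongDual ℝ X) (c : ℝ), 0 < c → (c : EReal) * conj f w ≠ ⊥ := by
      intro w c hc h
      rcases EReal.mul_eq_bot _ _ |>.1 h with h | h | h | h
      · exact EReal.coe_ne_bot _ h.1
      · exact hf.conj_ne_bot _ h.2
      · exact EReal.coe_ne_top _ h.1
      · exact absurd h.1 (not_lt.2 (by exact_mod_cast hc.le))
    by_cases hu : conj f u = ⊤
    · rw [hu, EReal.coe_mul_top_of_pos ha, EReal.top_add_of_ne_bot (hne v b hb)]
      exact le_top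
    by_cases hv : conj f v = ⊤
    · rw [hv, EReal.coe_mul_top_of_pos hb, EReal.add_top_of_ne_bot (hne u a ha)]
      exact le_top
    have hu' := EReal.coe_toReal hu (hf.conj_ne_bot u)
    have hv' := EReal.coe_toReal hv (hf.conj_ne_bot v)
    have h : conj f (a • u + b • v) ≤
        ((a * (conj f u).toReal + b * (conj f v).toReal : ℝ) : EReal) := by
      rw [hf.conj_le_iff]
      intro x hx
      have h1 := hf.conj_le_iff.1 hu'.ge x hx
      have h2 := hf.conj_le_iff.1 hv'.ge x hx
      have h3 := mul_le_mul_of_nonneg_left h1 ha.le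
      have h4 := mul_le_mul_of_nonneg_left h2 hb.le
      have h5 : (f x).toReal = a * (f x).toReal + b * (f x).toReal := by
        rw [← add_mul, hab, one_mul]
      simp only [add_apply, smul_apply, smul_eq_mul]
      linarith
    rw [← hu', ← hv']
    exact_mod_cast h

lemma IsGamma0.conj_eq_of_mem_subdiff (hf : IsGamma0 f) {x : X} {u : StrongDual ℝ X}
    (hu : u ∈ subdiff f x) : conj f u = ((u x - (f x).toReal : ℝ) : EReal) := by
  have hx := hf.mem_fdom_of_mem_subdiff hu
  refine le_antisymm (hf.conj_le_iff.2 fun y hy => ?_) (hf.sub_le_conj hx u)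
  have := (hf.mem_subdiff_iff hx).1 hu y hy
  rw [map_sub] at this
  linarith

lemma IsGamma0.mem_fdom_conj (hf : IsGamma0 f) {x : X} {u : StrongDual ℝ X}
    (hu : u ∈ subdiff f x) : u ∈ fdom (conj f) := by
  change conj f u < ⊤
  rw [hf.conj_eq_of_mem_subdiff hu]
  exact EReal.coe_lt_top _

lemma IsGamma0.inclusion_mem_subdiff_conj (hf : IsGamma0 f) {x : X} {u : StrongDual ℝ X}
    (hu : u ∈ subdiff f x) : NormedSpace.inclusionInDoubleDual ℝ X x ∈ subdiff (conj f) u := by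
  intro v
  have hx := hf.mem_fdom_of_mem_subdiff hu
  refine le_trans (le_of_eq ?_) (hf.sub_le_conj hx v)
  rw [hf.conj_eq_of_mem_subdiff hu, NormedSpace.dual_def, ← EReal.coe_add, sub_apply]
  congr 1
  ring

lemma IsGamma0.isClosed_epigraph (hf : IsGamma0 f) :
    IsClosed {p : X × ℝ | f p.1 ≤ (p.2 : EReal)} :=
  hf.lsc.isClosed_epigraph.preimage
    (f := fun p : X × ℝ => (p.1, (p.2 : EReal)))
    (continuous_fst.prodMk (continuous_coe_real_ereal.comp continuous_snd))

lemma IsGamma0.convex_epigraph (hf : IsGamma0 f) :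
    Convex ℝ {p : X × ℝ | f p.1 ≤ (p.2 : EReal)} := by
  have := hf.convexOn_toReal.convex_epigraph
  convert! this using 1
  ext p
  exact hf.le_coe_iff

/-- A subgradient of the conjugate that comes from the space itself is an inverse subgradient. -/
lemma IsGamma0.mem_subdiff_of_inclusion_mem (hf : IsGamma0 f) {x : X} {u : StrongDual ℝ X}
    (hx : NormedSpace.inclusionInDoubleDual ℝ X x ∈ subdiff (conj f) u)
    (hu : u ∈ fdom (conj f)) : u ∈ subdiff f x := by
  have hu' := EReal.coe_toReal hu.ne (hf.conj_ne_bot u)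
  set k := (conj f u).toReal with hk
  have hle : ∀ (v : StrongDual ℝ X) (c : ℝ), conj f v ≤ c → v x - u x + k ≤ c := by
    intro v c hc
    have h := (hx v).trans hc
    rw [← hu', NormedSpace.dual_def, sub_apply] at h
    exact_mod_cast h
  have hfx : f x ≤ ((u x - k : ℝ) : EReal) := by
    by_contra hcon
    obtain ⟨g, c, hg, hgx⟩ := geometric_hahn_banach_closed_point hf.convex_epigraph
      hf.isClosed_epigraph (x := (x, u x - k)) hcon
    have hsplit : ∀ y t, g (y, t) = g (y, 0) + t * g (0, 1) := by
      intro y t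
      have : ((y, t) : X × ℝ) = (y, 0) + t • (0, 1) := by ext1 <;> simp
      rw [this, map_add, map_smul, smul_eq_mul]
    have hmem : ∀ y ∈ fdom f, ∀ t, (f y).toReal ≤ t → g (y, 0) + t * g (0, 1) < c := by
      intro y hy t ht
      rw [← hsplit]
      exact hg _ (hf.le_coe_iff.2 ⟨hy, ht⟩)
    rw [hsplit] at hgx
    set b := g (0, 1) with hb
    -- A point `(x, u x - k)` outside the epigraph is strictly separated from it. If `b < 0`, the
    -- functional yields an affine minorant of `f` violating `hle`; if `b = 0`, adding it to `u`
    -- does so; `b > 0` is impossible as the epigraph is unbounded upwards.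
    rcases lt_trichotomy b 0 with hneg | hzero | hpos
    · let v : StrongDual ℝ X := (-b)⁻¹ • g.comp (ContinuousLinearMap.inl ℝ X ℝ)
      have hv : ∀ y, v y = (-b)⁻¹ * g (y, 0) := fun y => by simp [v]
      have h1 := hle v ((-b)⁻¹ * c) (hf.conj_le_iff.2 fun y hy => by
        have := hmem y hy _ le_rfl
        rw [hv, sub_le_iff_le_add, inv_mul_le_iff₀ (by linarith), mul_add,
          mul_inv_cancel_left₀ (by linarith)]
        linarith)
      rw [hv] at h1
      have h2 : (-b)⁻¹ * g (x, 0) ≤ (-b)⁻¹ * c + (u x - k) := by linarith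
      rw [inv_mul_le_iff₀ (by linarith), mul_add, mul_inv_cancel_left₀ (by linarith)] at h2
      linarith
    · let v : StrongDual ℝ X := g.comp (ContinuousLinearMap.inl ℝ X ℝ)
      have hv : ∀ y, v y = g (y, 0) := fun y => by simp [v]
      have h1 := hle (u + v) (k + c) (hf.conj_le_iff.2 fun y hy => by
        have h2 := hmem y hy _ le_rfl
        have h3 := hf.conj_le_iff.1 hu'.ge y hy
        rw [hzero, mul_zero] at h2
        rw [add_apply, hv]
        linarith)
      rw [add_apply, hv] at h1
      rw [hzero, mul_zero] at hgx
      linarith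
    · obtain ⟨y, hy⟩ := hf.proper
      have h1 := hmem y hy (max (f y).toReal ((c - g (y, 0)) / b)) (le_max_left _ _)
      have h2 := mul_le_mul_of_nonneg_right
        (le_max_right (f y).toReal ((c - g (y, 0)) / b)) hpos.le
      rw [div_mul_cancel₀ _ hpos.ne'] at h2
      linarith
  obtain ⟨hxd, hfx⟩ := hf.le_coe_iff.1 hfx
  rw [hf.mem_subdiff_iff hxd]
  intro y hy
  have := hf.conj_le_iff.1 hu'.ge y hy
  rw [map_sub]
  linarith

/-- By reflexivity, two subgradients of `f*` at `u` are points `x`, `y` with `u ∈ ∂f(x) ∩ ∂f(y)`.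
Then `u` is a subgradient along the whole segment, on which `f` is affine, against strict convexity.
-/
lemma IsGamma0.subsingleton_subdiff_conj (hX : IsReflexiveSpace X) (hf : IsGamma0 f)
    (hsc : ∀ s : Set X, s ⊆ opDom (subdiff f) → Convex ℝ s →
      StrictConvexOn ℝ s (fun x => (f x).toReal))
    {u : StrongDual ℝ X} (hu : u ∈ fdom (conj f)) : (subdiff (conj f) u).Subsingleton := by
  intro Φ hΦ Ψ hΨ
  obtain ⟨x, rfl⟩ := hX Φ
  obtain ⟨y, rfl⟩ := hX Ψ
  have hx := hf.mem_subdiff_of_inclusion_mem hΦ hu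
  have hy := hf.mem_subdiff_of_inclusion_mem hΨ hu
  congr 1
  by_contra hne
  have hxd := hf.mem_fdom_of_mem_subdiff hx
  have hyd := hf.mem_fdom_of_mem_subdiff hy
  have hc := hf.convexOn_toReal
  have hxs := (hf.mem_subdiff_iff hxd).1 hx
  have hys := (hf.mem_subdiff_iff hyd).1 hy
  have hseg : segment ℝ x y ⊆ opDom (subdiff f) := by
    rintro w ⟨a, b, ha, hb, hab, rfl⟩
    have hwd := hc.1 hxd hyd ha hb hab
    refine ⟨u, (hf.mem_subdiff_iff hwd).2 fun v hv => ?_⟩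
    have h1 := hc.2 hxd hyd ha hb hab
    have h2 := mul_le_mul_of_nonneg_left (hxs v hv) ha
    have h3 := mul_le_mul_of_nonneg_left (hys v hv) hb
    simp only [smul_eq_mul, map_sub, map_add, map_smul] at h1 h2 h3 ⊢
    obtain rfl : b = 1 - a := by linarith
    nlinarith
  have hm : (1 / 2 : ℝ) • x + (1 / 2 : ℝ) • y ∈ fdom f :=
    hc.1 hxd hyd (by norm_num) (by norm_num) (by norm_num)
  have h1 := (hsc _ hseg (convex_segment x y)).2 (left_mem_segment ℝ x y)
    (right_mem_segment ℝ x y) hne (show (0 : ℝ) < 1 / 2 by norm_num)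
    (show (0 : ℝ) < 1 / 2 by norm_num) (by norm_num)
  have h2 := hxs _ hm
  have h3 := hys _ hm
  simp only [smul_eq_mul, map_sub, map_add, map_smul] at h1 h2 h3
  linarith

end Conjugate

/-! ### Weak compactness, Ekeland's principle and boundedness along subsequences. -/

section WeakCompactness

variable {X : Type*} [NormedAddCommGroup X] [NormedSpace ℝ X]

/-- In the dual of a reflexive space, every bounded sequence has a subsequence that converges
pointwise. -/
lemma exists_subseq_tendsto_apply (hX : IsReflexiveSpace X) {u : ℕ → StrongDual ℝ X} {R : ℝ}
    (hu : ∀ n, ‖u n‖ ≤ R) :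
    ∃ (φ : ℕ → ℕ) (v : StrongDual ℝ X), StrictMono φ ∧
      ∀ x, Tendsto (fun n => u (φ n) x) atTop (𝓝 (v x)) := by
  let Y : Submodule ℝ (StrongDual ℝ X) := (Submodule.span ℝ (range u)).topologicalClosure
  have hYu : ∀ n, u n ∈ Y := fun n =>
    Submodule.le_topologicalClosure _ (Submodule.subset_span (mem_range_self n))
  have hYsep : TopologicalSpace.IsSeparable (Y : Set (StrongDual ℝ X)) := by
    have := ((countable_range u).isSeparable.span (R := ℝ)).closure
    simpa [Y, Submodule.topologicalClosure_coe] using this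
  obtain ⟨D, hD, hDY⟩ := hYsep
  -- a countable set of points that separates the elements of `Y`
  have hpt : ∀ d : StrongDual ℝ X, ∃ x : X, ‖x‖ ≤ 1 ∧ ‖d‖ ≤ 2 * |d x| := by
    intro d
    by_cases hd : d = 0
    · exact ⟨0, by simp, by simp [hd]⟩
    · obtain ⟨x, hx, hlt⟩ := d.exists_lt_apply_of_lt_opNorm
        (half_lt_self (norm_pos_iff.2 hd))
      refine ⟨x, hx.le, ?_⟩
      rw [Real.norm_eq_abs] at hlt
      linarith
  choose p hp1 hp2 using hpt
  have hsep : ∀ y ∈ Y, (∀ d ∈ D, y (p d) = 0) → y = 0 := by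
    intro y hy h0
    by_contra hne
    have hpos : 0 < ‖y‖ := norm_pos_iff.2 hne
    obtain ⟨d, hd, hdist⟩ := Metric.mem_closure_iff.1 (hDY hy) (‖y‖ / 4) (by linarith)
    rw [dist_eq_norm] at hdist
    have h1 : |d (p d)| ≤ ‖y - d‖ := by
      have h2 := (y - d).le_opNorm (p d)
      rw [sub_apply, h0 d hd, zero_sub, norm_neg, Real.norm_eq_abs] at h2
      nlinarith [hp1 d, norm_nonneg (y - d)]
    have h2 := hp2 d
    have h3 : ‖y‖ ≤ ‖y - d‖ + ‖d‖ := by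
      simpa using norm_add_le (y - d) d
    linarith
  have : Countable D := hD.to_subtype
  -- Sequential compactness of a countable product of intervals gives convergence at all the
  -- separating points at once.
  obtain ⟨a, -, φ, hφ, ha⟩ := (isCompact_univ_pi (X := fun _ : D => ℝ)
    (s := fun _ => Icc (-R) R) fun _ => isCompact_Icc).isSeqCompact
    (x := fun n (d : D) => u n (p d)) (by
      intro n d _
      have h1 := (u n).le_opNorm (p d)
      rw [Real.norm_eq_abs] at h1
      exact abs_le.1 (h1.trans (by nlinarith [hp1 d, hu n, norm_nonneg (u n)])))
  rw [tendsto_pi_nhds] at ha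
  let w : ℕ → WeakDual ℝ X := fun n => StrongDual.toWeakDual (u (φ n))
  have hK := WeakDual.isCompact_closedBall (𝕜 := ℝ) (0 : StrongDual ℝ X) R
  have hwK : ∀ n, w n ∈ WeakDual.toStrongDual ⁻¹' Metric.closedBall (0 : StrongDual ℝ X) R := by
    intro n
    simpa [w] using hu (φ n)
  have heval : ∀ x : X, Continuous fun y : WeakDual ℝ X => y x := fun x =>
    WeakDual.eval_continuous x
  -- Reflexivity makes the norm-closed subspace `Y` weak-* closed, so every cluster point stays in
  -- `Y` and is determined by its values `a`. Hence there is only one.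
  have hcl : ∀ y : WeakDual ℝ X, MapClusterPt y atTop w →
      WeakDual.toStrongDual y ∈ Y ∧ ∀ d : D, y (p d) = a d := by
    intro y hy
    constructor
    · by_contra hyY
      obtain ⟨Φ, c, hΦ, hΦc⟩ := geometric_hahn_banach_closed_point Y.convex
        (Submodule.isClosed_topologicalClosure _) hyY
      obtain ⟨x, rfl⟩ := hX Φ
      obtain ⟨n, hn⟩ := (hy.frequently ((heval x).continuousAt.eventually_const_lt hΦc)).exists
      exact absurd hn (not_lt.2 (hΦ _ (hYu (φ n))).le)
    · intro d
      have h1 : MapClusterPt (y (p d)) atTop fun n => w n (p d) :=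
        hy.continuousAt_comp (heval (p d)).continuousAt
      have h2 : ClusterPt (y (p d)) (𝓝 (a d)) := ClusterPt.mono h1 (ha d)
      exact eq_of_nhds_neBot h2
  obtain ⟨v, -, hv⟩ := hK.exists_mapClusterPt (u := w) (f := atTop)
    (tendsto_principal.2 (Eventually.of_forall hwK))
  refine ⟨φ, WeakDual.toStrongDual v, hφ, fun x => ?_⟩
  have hlim : Tendsto w atTop (𝓝 v) := by
    refine hK.tendsto_nhds_of_unique_mapClusterPt (Eventually.of_forall hwK) fun y _ hy => ?_
    have h1 := hsep _ (Y.sub_mem (hcl y hy).1 (hcl v hv).1) fun d hd => by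
      rw [sub_apply, WeakDual.toStrongDual_apply, WeakDual.toStrongDual_apply,
        (hcl y hy).2 ⟨d, hd⟩, (hcl v hv).2 ⟨d, hd⟩, sub_self]
    exact WeakDual.toStrongDual.injective (sub_eq_zero.1 h1)
  exact ((heval x).tendsto v).comp hlim

end WeakCompactness

/-- Ekeland's variational principle, for a closed subset of `X × ℝ` that is bounded below. -/
lemma exists_ekeland {X : Type*} [MetricSpace X] [CompleteSpace X] {E : Set (X × ℝ)}
    (hE : IsClosed E) {m ε : ℝ} (hm : ∀ p ∈ E, m ≤ p.2) (hε : 0 < ε) {p₀ : X × ℝ}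
    (hp₀ : p₀ ∈ E) :
    ∃ p ∈ E, p.2 + ε * dist p.1 p₀.1 ≤ p₀.2 ∧ ∀ q ∈ E, p.2 ≤ q.2 + ε * dist q.1 p.1 := by
  have hstep : ∀ (n : ℕ) (p : E), ∃ q : E, q.1.2 + ε * dist q.1.1 p.1.1 ≤ p.1.2 ∧
      ∀ q' ∈ E, q'.2 + ε * dist q'.1 p.1.1 ≤ p.1.2 → q.1.2 ≤ q'.2 + 1 / ((n : ℝ) + 1) := by
    intro n p
    let S : Set ℝ := Prod.snd '' {q | q ∈ E ∧ q.2 + ε * dist q.1 p.1.1 ≤ p.1.2}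
    have hne : S.Nonempty := ⟨_, p.1, ⟨p.2, by simp⟩, rfl⟩
    have hbdd : BddBelow S := ⟨m, by rintro _ ⟨q, hq, rfl⟩; exact hm q hq.1⟩
    obtain ⟨_, ⟨q, hq, rfl⟩, hlt⟩ := Real.lt_sInf_add_pos hne (Nat.one_div_pos_of_nat (n := n))
    refine ⟨⟨q, hq.1⟩, hq.2, fun q' hq' h' => ?_⟩
    have := csInf_le hbdd ⟨q', ⟨hq', h'⟩, rfl⟩
    linarith
  choose nx hnx hnx' using hstep
  let s : ℕ → E := fun n => Nat.rec ⟨p₀, hp₀⟩ nx n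
  have hs : ∀ n, s (n + 1) = nx n (s n) := fun n => rfl
  let y : ℕ → X := fun n => (s n).1.1
  let t : ℕ → ℝ := fun n => (s n).1.2
  have hle : ∀ n k, t (n + k) + ε * dist (y (n + k)) (y n) ≤ t n := by
    intro n k
    induction k with
    | zero => simp
    | succ k ih =>
      have h1 : t (n + k + 1) + ε * dist (y (n + k + 1)) (y (n + k)) ≤ t (n + k) :=
        hnx (n + k) (s (n + k))
      have h2 := mul_le_mul_of_nonneg_left
        (dist_triangle (y (n + k + 1)) (y (n + k)) (y n)) hε.le
      rw [← add_assoc]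
      linarith
  have hanti : Antitone t := antitone_nat_of_succ_le fun n => by
    have h1 := hle n 1
    have h2 : 0 ≤ ε * dist (y (n + 1)) (y n) := by positivity
    linarith
  have hbdd : BddBelow (range t) := ⟨m, by rintro _ ⟨n, rfl⟩; exact hm _ (s n).2⟩
  have ht := tendsto_atTop_ciInf hanti hbdd
  set τ := ⨅ n, t n
  have hτ : ∀ n, τ ≤ t n := fun n => ciInf_le hbdd n
  have hdist : ∀ n k, dist (y (n + k)) (y n) ≤ ε⁻¹ * (t n - τ) := by
    intro n k
    rw [le_inv_mul_iff₀ hε]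
    linarith [hle n k, hτ (n + k)]
  have hcau : CauchySeq y := by
    refine cauchySeq_of_le_tendsto_0' (fun n => ε⁻¹ * (t n - τ)) (fun n k hnk => ?_) ?_
    · obtain ⟨j, rfl⟩ := Nat.exists_eq_add_of_le hnk
      rw [dist_comm]
      exact hdist n j
    · have := (ht.sub_const τ).const_mul ε⁻¹
      rwa [sub_self, mul_zero] at this
  obtain ⟨x, hx⟩ := cauchySeq_tendsto_of_complete hcau
  have hlim : ∀ n, τ + ε * dist x (y n) ≤ t n := by
    intro n
    have h1 : Tendsto (fun k => t k + ε * dist (y k) (y n)) atTop (𝓝 (τ + ε * dist x (y n))) :=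
      ht.add ((hx.dist tendsto_const_nhds).const_mul ε)
    refine le_of_tendsto h1 (eventually_atTop.2 ⟨n, fun k hk => ?_⟩)
    obtain ⟨j, rfl⟩ := Nat.exists_eq_add_of_le hk
    exact hle n j
  refine ⟨(x, τ), hE.mem_of_tendsto (hx.prodMk_nhds ht) (Eventually.of_forall fun n => (s n).2),
    hlim 0, fun q hq => ?_⟩
  -- Such a `q` is a competitor at every step, so near-minimality gives `τ ≤ q.2`, a contradiction.
  by_contra! hcon
  have h1 : ∀ n, t (n + 1) ≤ q.2 + 1 / ((n : ℝ) + 1) := by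
    intro n
    refine hnx' n (s n) q hq ?_
    have h2 := mul_le_mul_of_nonneg_left (dist_triangle q.1 x (y n)) hε.le
    have h3 := hlim n
    simp only at hcon
    change q.2 + ε * dist q.1 (y n) ≤ t n
    linarith
  have h2 : Tendsto (fun n : ℕ => q.2 + 1 / ((n : ℝ) + 1)) atTop (𝓝 (q.2 + 0)) :=
    tendsto_one_div_add_atTop_nhds_zero_nat.const_add _
  have h3 := le_of_tendsto_of_tendsto' ((tendsto_add_atTop_iff_nat 1).2 ht) h2 h1
  have h4 : 0 ≤ ε * dist q.1 x := by positivity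
  simp only at hcon
  linarith

/-- A bound on `‖x‖` along sequences follows from bounds along subsequences. -/
lemma isBounded_range_of_subseq {X : Type*} [SeminormedAddCommGroup X]
    {x : ℕ → X}
    (h : ∀ ψ : ℕ → ℕ, ∃ φ : ℕ → ℕ, StrictMono φ ∧ ∃ K : ℝ, ∃ᶠ n in atTop, ‖x (ψ (φ n))‖ ≤ K) :
    Bornology.IsBounded (range x) := by
  by_contra hcon
  have hunb : ∀ n : ℕ, ∃ k, (n : ℝ) < ‖x k‖ := by
    by_contra! hc
    obtain ⟨n, hn⟩ := hc
    exact hcon (isBounded_iff_forall_norm_le.2 ⟨n, by rintro _ ⟨k, rfl⟩; exact hn k⟩)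
  choose ψ hψ using hunb
  obtain ⟨φ, hφ, K, hK⟩ := h ψ
  obtain ⟨N, hN⟩ := exists_nat_ge K
  obtain ⟨n, hn, hnN⟩ := (hK.and_eventually (eventually_ge_atTop N)).exists
  have h1 : (N : ℝ) ≤ φ n := by exact_mod_cast hnN.trans (hφ.id_le n)
  linarith [hψ (φ n)]

/-! ### Boundedness of left Bregman balls and of sequences in them. -/

section Boundedness

variable {X : Type*} [NormedAddCommGroup X] [NormedSpace ℝ X] {f : X → EReal}

lemma norm_le_of_forall_apply_le {u : StrongDual ℝ X} {r K : ℝ} (hr : 0 < r)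
    (h : ∀ y, ‖y‖ ≤ r → u y ≤ K) : ‖u‖ ≤ K / r := by
  have hK : 0 ≤ K := by simpa using h 0 (by simpa using hr.le)
  refine u.opNorm_le_of_unit_norm (by positivity) fun y hy => ?_
  have hn : ‖r • y‖ ≤ r := by rw [norm_smul, hy, mul_one, Real.norm_of_nonneg hr.le]
  have h1 := h (r • y) hn
  have h2 := h (-(r • y)) (by rwa [norm_neg])
  rw [map_neg, map_smul, smul_eq_mul] at h2
  rw [map_smul, smul_eq_mul] at h1
  rw [Real.norm_eq_abs, abs_le]
  rw [← neg_div, div_le_iff₀ hr, le_div_iff₀ hr]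
  constructor <;> linarith

lemma norm_inclusionInDoubleDual (x : X) : ‖NormedSpace.inclusionInDoubleDual ℝ X x‖ = ‖x‖ :=
  (NormedSpace.inclusionInDoubleDualLi ℝ).norm_map x

/-- If `x` almost minimizes `f - u₀` up to a multiple of the norm, then some subgradient of `f`
at `x` is close to `u₀`. -/
lemma IsGamma0.exists_mem_subdiff_norm_sub_le (hf : IsGamma0 f) {x : X} (hx : x ∈ fdom f)
    {u₀ : StrongDual ℝ X} {ε : ℝ} (hε : 0 ≤ ε)
    (h : ∀ y ∈ fdom f, (f x).toReal + u₀ (y - x) ≤ (f y).toReal + ε * ‖y - x‖) :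
    ∃ u ∈ subdiff f x, ‖u - u₀‖ ≤ ε := by
  set k := (f x).toReal with hk
  let G : X → ℝ := fun y => ε * ‖y - x‖ - u₀ (y - x)
  have hGc : ConvexOn ℝ univ G := by
    have h1 : ConvexOn ℝ univ fun y : X => ‖y - x‖ := by
      simpa [dist_eq_norm] using convexOn_univ_dist x
    have h2 : ConcaveOn ℝ univ fun y : X => u₀ (y - x) := by
      refine ⟨convex_univ, fun y _ y' _ a b _ _ hab => le_of_eq ?_⟩
      simp only [map_sub, map_add, map_smul, smul_eq_mul]
      obtain rfl : b = 1 - a := by linarith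
      ring
    exact (h1.smul hε).sub h2
  have hGcont : Continuous G := by fun_prop
  -- The strict hypograph of `y ↦ k + u₀ (y - x) - ε‖y - x‖`, a concave minorant touching `f` at
  -- `x`. An affine function between it and `f` has the required slope.
  let H : Set (X × ℝ) := {p | p.2 < k - G p.1}
  have hHo : IsOpen H := isOpen_lt continuous_snd (continuous_const.sub (hGcont.comp continuous_fst))
  have hHc : Convex ℝ H := by
    rintro ⟨y, s⟩ hy ⟨y', s'⟩ hy' a b ha hb hab
    have h1 := hGc.2 (mem_univ y) (mem_univ y') ha hb hab
    simp only [H, mem_ofPred_eq, Prod.fst_add, Prod.snd_add, Prod.smul_fst, Prod.smul_snd,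
      smul_eq_mul] at hy hy' h1 ⊢
    obtain rfl : b = 1 - a := by linarith
    rcases ha.eq_or_lt with rfl | ha'
    · simp only [zero_smul, zero_add, sub_zero, one_smul, zero_mul, one_mul] at h1 ⊢
      exact hy'
    · nlinarith
  have hdisj : Disjoint H {p : X × ℝ | f p.1 ≤ (p.2 : EReal)} := by
    rw [Set.disjoint_left]
    rintro ⟨y, s⟩ hp hq
    obtain ⟨hy, hys⟩ := hf.le_coe_iff.1 hq
    have := h y hy
    simp only [H, G, mem_ofPred_eq] at hp hys
    linarith
  obtain ⟨g, c, hg, hg'⟩ := geometric_hahn_banach_open hHc hHo hf.convex_epigraph hdisj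
  have hsplit : ∀ y t, g (y, t) = g (y, 0) + t * g (0, 1) := by
    intro y t
    have : ((y, t) : X × ℝ) = (y, 0) + t • (0, 1) := by ext1 <;> simp
    rw [this, map_add, map_smul, smul_eq_mul]
  set b := g (0, 1) with hb
  have hG0 : G x = 0 := by simp [G]
  have hepi : ∀ y ∈ fdom f, c ≤ g (y, 0) + (f y).toReal * b := fun y hy => by
    rw [← hsplit]
    exact hg' _ (hf.coe_toReal hy).ge
  have hbpos : 0 < b := by
    have h1 : g (x, k - 1) < c := hg _ (by simp [H, hG0])
    rw [hsplit] at h1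
    linarith [hepi x hx]
  have hhyp : ∀ y, g (y, 0) + (k - G y) * b ≤ c := by
    intro y
    refine le_of_forall_pos_le_add fun η hη => ?_
    have h1 : g (y, k - G y - η / b) < c := hg _ (by simpa [H] using div_pos hη hbpos)
    rw [hsplit, sub_mul, div_mul_cancel₀ _ hbpos.ne'] at h1
    linarith
  let u : StrongDual ℝ X := -(b⁻¹ • g.comp (ContinuousLinearMap.inl ℝ X ℝ))
  have hu : ∀ y, u y = -(b⁻¹ * g (y, 0)) := fun y => by simp [u]
  have hsub : ∀ y y', g (y - y', 0) = g (y, 0) - g (y', 0) := fun y y' => by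
    rw [← map_sub]
    simp
  refine ⟨u, (hf.mem_subdiff_iff hx).2 fun y hy => ?_, ?_⟩
  · have h1 := hhyp x
    have h2 := hepi y hy
    rw [hG0, sub_zero] at h1
    have h3 : b⁻¹ * (k * b - (f y).toReal * b) ≤ b⁻¹ * (g (y, 0) - g (x, 0)) :=
      mul_le_mul_of_nonneg_left (by linarith) (inv_pos.2 hbpos).le
    rw [← sub_mul, mul_comm, mul_inv_cancel_right₀ hbpos.ne'] at h3
    rw [hu, hsub]
    linarith
  · rw [norm_sub_rev]
    have h1 : ∀ y, ‖y‖ ≤ 1 → (u₀ - u) y ≤ ε := by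
      intro y hy
      have h1 := hhyp (x + y)
      have h2 := hepi x hx
      have h3 : g (x + y, 0) = g (x, 0) + g (y, 0) := by
        rw [← map_add]
        simp
      simp only [G, add_sub_cancel_left] at h1
      have h4 : b⁻¹ * g (y, 0) ≤ ε * ‖y‖ - u₀ y := by
        rw [inv_mul_le_iff₀ hbpos]
        linarith
      rw [sub_apply, hu]
      nlinarith
    simpa using norm_le_of_forall_apply_le one_pos h1

/-- If `∂f*` is locally bounded at `u₀ ∈ ∂f(z)`, then `f - u₀` has bounded sublevel sets. -/
lemma IsGamma0.exists_norm_le_of_isLocallyBoundedOnDom [CompleteSpace X] (hf : IsGamma0 f)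
    (hb : IsLocallyBoundedOnDom (subdiff (conj f))) {z : X} {u₀ : StrongDual ℝ X}
    (hu₀ : u₀ ∈ subdiff f z) (M : ℝ) :
    ∃ R : ℝ, ∀ x ∈ fdom f, (f x).toReal - (f z).toReal - u₀ (x - z) ≤ M → ‖x‖ ≤ R := by
  have hz := hf.mem_fdom_of_mem_subdiff hu₀
  have hz' := (hf.mem_subdiff_iff hz).1 hu₀
  obtain ⟨U, hU, hbd⟩ := hb u₀ ⟨_, hf.inclusion_mem_subdiff_conj hu₀⟩
  obtain ⟨R, hR⟩ := hbd.exists_norm_le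
  obtain ⟨ε, hε, hεU⟩ := Metric.nhds_basis_closedBall.mem_iff.1 hU
  refine ⟨R + M / ε, fun x hx hxM => ?_⟩
  let E : Set (X × ℝ) := {p | f p.1 ≤ ((p.2 + u₀ p.1 : ℝ) : EReal)}
  have hE : IsClosed E := hf.isClosed_epigraph.preimage
    (f := fun p : X × ℝ => (p.1, p.2 + u₀ p.1)) (by fun_prop)
  have hEiff : ∀ {p : X × ℝ}, p ∈ E ↔ p.1 ∈ fdom f ∧ (f p.1).toReal ≤ p.2 + u₀ p.1 := fun {p} =>
    hf.le_coe_iff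
  have hm : ∀ p ∈ E, (f z).toReal - u₀ z ≤ p.2 := by
    intro p hp
    obtain ⟨h1, h2⟩ := hEiff.1 hp
    have := hz' _ h1
    rw [map_sub] at this
    linarith
  have hp₀ : ((x, (f x).toReal - u₀ x) : X × ℝ) ∈ E := hEiff.2 ⟨hx, by simp⟩
  -- Ekeland's principle for `f - u₀` moves `x` by at most `M / ε` to a point with a subgradient in
  -- the `ε`-ball about `u₀`, where `∂f*` is bounded by `R`.
  obtain ⟨p, hp, hpx, hpmin⟩ := exists_ekeland hE hm hε hp₀
  have hmp := hm p hp
  obtain ⟨hpd, hpE⟩ := hEiff.1 hp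
  obtain ⟨u, hu, hun⟩ := hf.exists_mem_subdiff_norm_sub_le hpd (u₀ := u₀) hε.le (fun y hy => by
    have h1 := hpmin (y, (f y).toReal - u₀ y) (hEiff.2 ⟨hy, by simp⟩)
    simp only [dist_eq_norm] at h1
    rw [map_sub]
    linarith)
  have h1 : ‖p.1‖ ≤ R := by
    have := hR _ (mem_biUnion (hεU (by rwa [mem_closedBall_iff_norm]))
      (hf.inclusion_mem_subdiff_conj hu))
    rwa [norm_inclusionInDoubleDual] at this
  have h2 : dist p.1 x ≤ M / ε := by
    rw [le_div_iff₀ hε]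
    rw [map_sub] at hxM
    simp only at hpx
    linarith
  have h3 : ‖x‖ ≤ ‖p.1‖ + dist p.1 x := by
    rw [dist_comm, dist_eq_norm]
    simpa using norm_add_le p.1 (x - p.1)
  linarith

/-- The gradients at the points of a left Bregman ball are bounded. -/
lemma IsGamma0.exists_norm_grad_le [CompleteSpace X] (hf : IsGamma0 f) {z : X}
    (hz : z ∈ interior (fdom f)) (M : ℝ) :
    ∃ R : ℝ, 0 ≤ R ∧ ∀ y ∈ opDom (gradOp f), realBreg f z y ≤ M → ‖grad f y‖ ≤ R := by
  obtain ⟨r, hr, K, hK⟩ := hf.exists_forall_closedBall_le hz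
  refine ⟨max ((K - (f z).toReal + M) / r) 0, le_max_right _ _, fun y hy hM => ?_⟩
  -- The subgradient inequality at `y` is tested at `z + h` with `‖h‖ ≤ r`, where `f ≤ K`.
  refine le_trans (norm_le_of_forall_apply_le hr fun h hh => ?_) (le_max_left _ _)
  obtain ⟨h1, h2⟩ := hK (z + h) (by simpa using hh)
  have hu := hf.grad_mem_subdiff hy
  have h3 := (hf.mem_subdiff_iff (hf.mem_fdom_of_mem_subdiff hu)).1 hu _ h1
  rw [realBreg] at hM
  have h4 : z + h - y = (z - y) + h := by abel
  rw [h4, map_add] at h3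
  linarith

/-- On the ball the gradients are bounded by some `K`, so `f y ≤ f z + K (‖z‖ + ‖y‖)`, whereas
supercoercivity gives `f y > (K + 1) ‖y‖` for large `‖y‖`. -/
lemma IsGamma0.exists_norm_le_of_isSupercoercive [CompleteSpace X] (hf : IsGamma0 f)
    (hsc : IsSupercoercive f) {z : X} (hz : z ∈ interior (fdom f)) (M : ℝ) :
    ∃ R : ℝ, ∀ y ∈ opDom (gradOp f), realBreg f z y ≤ M → ‖y‖ ≤ R := by
  obtain ⟨K, hK0, hK⟩ := hf.exists_norm_grad_le hz M
  have h1 : ∀ᶠ x in Bornology.cobounded X, ((K + 1 : ℝ) : EReal) < f x / ((‖x‖ : ℝ) : EReal) :=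
    hsc.eventually_const_lt (EReal.coe_lt_top _)
  have h2 : Bornology.IsBounded
      {x | ((K + 1 : ℝ) : EReal) < f x / ((‖x‖ : ℝ) : EReal)}ᶜ := by
    rw [Bornology.isBounded_def, compl_compl]
    exact h1
  obtain ⟨ρ, hρ⟩ := h2.exists_norm_le
  refine ⟨max (max ρ 0) ((f z).toReal + K * ‖z‖), fun y hy hM => ?_⟩
  by_contra! hcon
  obtain ⟨h3, h4⟩ := max_lt_iff.1 hcon
  obtain ⟨h3, h5⟩ := max_lt_iff.1 h3
  have h6 : ((K + 1 : ℝ) : EReal) < f y / ((‖y‖ : ℝ) : EReal) := by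
    by_contra h
    exact absurd (hρ y h) (not_le.2 h3)
  have hu := hf.grad_mem_subdiff hy
  have hyd := hf.mem_fdom_of_mem_subdiff hu
  rw [← hf.coe_toReal hyd, ← EReal.coe_div, EReal.coe_lt_coe_iff, lt_div_iff₀ h5] at h6
  have h7 := (hf.mem_subdiff_iff hyd).1 hu z (interior_subset hz)
  have h8 := (grad f y).le_opNorm (z - y)
  rw [Real.norm_eq_abs] at h8
  have h9 := (abs_le.1 h8).1
  have h10 : ‖grad f y‖ * ‖z - y‖ ≤ K * (‖z‖ + ‖y‖) :=
    mul_le_mul (hK y hy hM) (norm_sub_le z y) (norm_nonneg _) hK0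
  linarith

/-- Uniform convexity between `y` and the point `p` of the segment towards `z` at distance one,
rescaled by convexity, gives `D_f(z, y) ≥ (φ 1 / 2) ‖z - y‖` as soon as `‖z - y‖ > 1`. -/
lemma IsGamma0.exists_norm_le_of_isUniformlyConvex (hf : IsGamma0 f)
    (huc : IsUniformlyConvex f) {z : X} (hz : z ∈ fdom f) (M : ℝ) :
    ∃ R : ℝ, ∀ y ∈ opDom (gradOp f), realBreg f z y ≤ M → ‖y‖ ≤ R := by
  obtain ⟨φ, -, hφ, hconv⟩ := huc
  have hφ1 := hφ 1 one_pos
  refine ⟨‖z‖ + max 1 (M / (φ 1 / 2)), fun y hy hM => ?_⟩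
  have hyd := hf.mem_fdom_of_mem_subdiff (hf.grad_mem_subdiff hy)
  suffices h : ‖z - y‖ ≤ max 1 (M / (φ 1 / 2)) by
    have := norm_sub_le z (z - y)
    rw [sub_sub_cancel] at this
    linarith
  rcases le_or_gt ‖z - y‖ 1 with h1 | h1
  · exact h1.trans (le_max_left _ _)
  refine le_trans ?_ (le_max_right _ _)
  rw [le_div_iff₀ (by linarith)]
  set t := ‖z - y‖ with ht
  have ht0 : 0 < t := one_pos.trans h1
  have hit : t⁻¹ ≤ 1 := inv_le_one_of_one_le₀ h1.le
  have hit0 : 0 < t⁻¹ := inv_pos.2 ht0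
  set p := (1 - t⁻¹) • y + t⁻¹ • z with hp
  have hpd : p ∈ fdom f := hconv.1 hyd hz (by linarith) hit0.le (by ring)
  have hpy : p - y = t⁻¹ • (z - y) := by
    rw [hp]
    module
  have hnorm : ‖y - p‖ = 1 := by
    rw [norm_sub_rev, hpy, norm_smul, Real.norm_of_nonneg hit0.le, ← ht,
      inv_mul_cancel₀ ht0.ne']
  have h2 := hf.convexOn_toReal.2 hyd hz (show 0 ≤ 1 - t⁻¹ by linarith) hit0.le (by ring)
  have h3 := hconv.2 hyd hpd (show (0 : ℝ) ≤ 1 / 2 by norm_num)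
    (show (0 : ℝ) ≤ 1 / 2 by norm_num) (by norm_num)
  have h4 := hf.realBreg_nonneg (hconv.1 hyd hpd (show (0 : ℝ) ≤ 1 / 2 by norm_num)
    (show (0 : ℝ) ≤ 1 / 2 by norm_num) (by norm_num)) hy
  rw [← hp] at h2
  rw [hnorm] at h3
  have h5 : (1 / 2 : ℝ) • y + (1 / 2 : ℝ) • p - y = (1 / 2 : ℝ) • t⁻¹ • (z - y) := by
    rw [← hpy]
    module
  rw [realBreg, h5, map_smul, map_smul] at h4
  rw [realBreg] at hM
  simp only [smul_eq_mul] at h2 h3 h4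
  have h6 : φ 1 / 2 ≤ t⁻¹ * M := by
    have := mul_le_mul_of_nonneg_left hM hit0.le
    linarith
  rw [le_inv_mul_iff₀ ht0] at h6
  exact h6

/-- The conjugate is bounded along the gradients at the points of a left Bregman ball. -/
lemma IsGamma0.exists_conj_grad_le [CompleteSpace X] (hf : IsGamma0 f) {z : X}
    (hz : z ∈ interior (fdom f)) (M : ℝ) :
    ∃ K : ℝ, ∀ y ∈ opDom (gradOp f), realBreg f z y ≤ M → conj f (grad f y) ≤ (K : EReal) := by
  obtain ⟨R, hR, h⟩ := hf.exists_norm_grad_le hz M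
  refine ⟨M - (f z).toReal + R * ‖z‖, fun y hy hM => ?_⟩
  -- Fenchel–Young equality gives `f*(∇f(y)) = D_f(z, y) - f z + ⟨z, ∇f(y)⟩`.
  rw [hf.conj_eq_of_mem_subdiff (hf.grad_mem_subdiff hy), EReal.coe_le_coe_iff]
  have h1 := (grad f y).le_of_opNorm_le (h y hy hM) z
  rw [Real.norm_eq_abs] at h1
  have h2 := (abs_le.1 h1).2
  rw [realBreg, map_sub] at hM
  linarith

lemma IsGamma0.conj_le_of_tendsto_apply (hf : IsGamma0 f) {u : ℕ → StrongDual ℝ X}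
    {v : StrongDual ℝ X} {K : ℝ} (hu : ∀ n, conj f (u n) ≤ (K : EReal))
    (h : ∀ x, Tendsto (fun n => u n x) atTop (𝓝 (v x))) : conj f v ≤ (K : EReal) :=
  hf.conj_le_iff.2 fun x hx =>
    le_of_tendsto' ((h x).sub_const _) fun n => hf.conj_le_iff.1 (hu n) x hx

/-- A subsequence of the bounded gradients converges weakly to some `v`, and `v ∈ dom f*` because
`f*` is bounded along them. As `∇f*` inverts `∇f`, its weak continuity makes the points converge
weakly, hence stay bounded by Banach–Steinhaus. -/
lemma IsGamma0.isBounded_range_of_isWeaklySeqContinuousOn [CompleteSpace X]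
    (hX : IsReflexiveSpace X) (hf : IsGamma0 f) (hsc : IsEssStrictlyConvex f)
    (ho : IsOpen (fdom (conj f)))
    (hw : IsWeaklySeqContinuousOn (grad (conj f)) (fdom (conj f)))
    {z : X} (hz : z ∈ interior (fdom f)) {x : ℕ → X} (hx : ∀ n, x n ∈ opDom (gradOp f)) {M : ℝ}
    (hM : ∀ n, realBreg f z (x n) ≤ M) : Bornology.IsBounded (range x) := by
  obtain ⟨R, -, hR⟩ := hf.exists_norm_grad_le hz M
  obtain ⟨K, hK⟩ := hf.exists_conj_grad_le hz M
  have hsub : ∀ n, grad f (x n) ∈ subdiff f (x n) := fun n => hf.grad_mem_subdiff (hx n)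
  have hd : ∀ n, grad f (x n) ∈ fdom (conj f) := fun n => hf.mem_fdom_conj (hsub n)
  have hcg : IsGamma0 (conj f) := hf.isGamma0_conj ⟨_, hd 0⟩
  have hgrad : ∀ n, grad (conj f) (grad f (x n)) =
      NormedSpace.inclusionInDoubleDual ℝ X (x n) := by
    intro n
    have hss := hf.subsingleton_subdiff_conj hX hsc.2 (hd n)
    obtain ⟨Φ, hΦ⟩ := hcg.exists_mem_gradOp (ho.interior_eq.symm ▸ hd n) hss
    rw [grad_eq hΦ]
    exact hss (hcg.gradOp_subset_subdiff _ hΦ) (hf.inclusion_mem_subdiff_conj (hsub n))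
  refine isBounded_range_of_subseq fun ψ => ?_
  obtain ⟨φ, v, hφ, hv⟩ := exists_subseq_tendsto_apply hX
    (u := fun n => grad f (x (ψ n))) fun n => hR _ (hx _) (hM _)
  have hvd : v ∈ fdom (conj f) :=
    (hf.conj_le_of_tendsto_apply (fun n => hK _ (hx (ψ (φ n))) (hM _)) hv).trans_lt
      (EReal.coe_lt_top K)
  have hlim := hw (fun n => grad f (x (ψ (φ n)))) v (fun n => hd _) hvd fun Φ => by
    obtain ⟨y, rfl⟩ := hX Φ
    exact hv y
  have hpt : ∀ u : StrongDual ℝ X, ∃ C, ∀ n,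
      ‖NormedSpace.inclusionInDoubleDual ℝ X (x (ψ (φ n))) u‖ ≤ C := by
    intro u
    have h1 := hlim (NormedSpace.inclusionInDoubleDual ℝ (StrongDual ℝ X) u)
    simp only [NormedSpace.dual_def, hgrad] at h1
    obtain ⟨C, hC⟩ := (Metric.isBounded_range_of_tendsto _ h1).exists_norm_le
    exact ⟨C, fun n => hC _ ⟨n, rfl⟩⟩
  obtain ⟨C, hC⟩ := banach_steinhaus hpt
  refine ⟨φ, hφ, C, Frequently.of_forall fun n => ?_⟩
  have := hC n
  rwa [norm_inclusionInDoubleDual] at this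

/-- The gradients subconverge in norm to a point of the open set `dom f*`, near which `f*` is
bounded above; the points `x n`, being subgradients of `f*` there, are bounded. -/
lemma IsGamma0.isBounded_range_of_finiteDimensional [FiniteDimensional ℝ X] [CompleteSpace X]
    (hf : IsGamma0 f) (ho : IsOpen (fdom (conj f))) {z : X} (hz : z ∈ interior (fdom f))
    {x : ℕ → X} (hx : ∀ n, x n ∈ opDom (gradOp f)) {M : ℝ}
    (hM : ∀ n, realBreg f z (x n) ≤ M) : Bornology.IsBounded (range x) := by
  obtain ⟨R, -, hR⟩ := hf.exists_norm_grad_le hz M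
  obtain ⟨K, hK⟩ := hf.exists_conj_grad_le hz M
  have hsub : ∀ n, grad f (x n) ∈ subdiff f (x n) := fun n => hf.grad_mem_subdiff (hx n)
  have hd : ∀ n, grad f (x n) ∈ fdom (conj f) := fun n => hf.mem_fdom_conj (hsub n)
  have hcg : IsGamma0 (conj f) := hf.isGamma0_conj ⟨_, hd 0⟩
  have : ProperSpace (StrongDual ℝ X) := FiniteDimensional.proper_real _
  refine isBounded_range_of_subseq fun ψ => ?_
  obtain ⟨v, -, φ, hφ, hv⟩ := tendsto_subseq_of_bounded Metric.isBounded_closedBall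
    (x := fun n => grad f (x (ψ n))) (s := Metric.closedBall 0 R) fun n => by
      simpa using hR _ (hx (ψ n)) (hM _)
  have hva : ∀ y, Tendsto (fun n => grad f (x (ψ (φ n))) y) atTop (𝓝 (v y)) := fun y =>
    ((ContinuousLinearMap.apply ℝ ℝ y).continuous.tendsto v).comp hv
  have hvd : v ∈ fdom (conj f) :=
    (hf.conj_le_of_tendsto_apply (fun n => hK _ (hx (ψ (φ n))) (hM _)) hva).trans_lt
      (EReal.coe_lt_top K)
  obtain ⟨r, hr, L, hL⟩ := hcg.exists_forall_closedBall_le (ho.interior_eq.symm ▸ hvd)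
  refine ⟨φ, hφ, (L + R * ‖z‖ + (f z).toReal) / (r / 2), Eventually.frequently ?_⟩
  filter_upwards [hv.eventually (Metric.closedBall_mem_nhds v (half_pos hr))] with n hn
  rw [Function.comp_apply] at hn
  set y := x (ψ (φ n)) with hy
  have hyu : grad f y ∈ subdiff f y := hsub _
  have hyc : ((conj f (grad f y)).toReal : EReal) = conj f (grad f y) :=
    hcg.coe_toReal (hd _)
  have h1 : ‖NormedSpace.inclusionInDoubleDual ℝ X y‖ ≤
      (L + R * ‖z‖ + (f z).toReal) / (r / 2) := by
    refine norm_le_of_forall_apply_le (half_pos hr) fun h hh => ?_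
    have h2 : grad f y + h ∈ Metric.closedBall v r := by
      rw [dist_eq_norm] at hn
      rw [mem_closedBall_iff_norm]
      have : grad f y + h - v = (grad f y - v) + h := by abel
      rw [this]
      exact (norm_add_le _ _).trans (by linarith)
    obtain ⟨h3, h4⟩ := hL _ h2
    have h5 := (hcg.mem_subdiff_iff (hd _)).1 (hf.inclusion_mem_subdiff_conj hyu) _ h3
    rw [add_sub_cancel_left] at h5
    have h6 := hf.conj_le_iff.1 hyc.ge z (interior_subset hz)
    have h7 := (grad f y).le_of_opNorm_le (hR _ (hx _) (hM _)) z
    rw [Real.norm_eq_abs] at h7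
    have h8 := (abs_le.1 h7).1
    linarith
  rwa [norm_inclusionInDoubleDual] at h1

/-- A positive ratio exchanges the arguments: `D_f(y, z) ≤ M / ρ`. The sublevel sets of `D_f(·, z)`
are bounded by local boundedness of `∂f*` at `∇f(z)`. -/
lemma IsGamma0.exists_norm_le_of_symRatio_pos [CompleteSpace X] (hf : IsGamma0 f)
    (hG : IsGateauxDiffOn f (interior (fdom f))) (hsc : IsEssStrictlyConvex f)
    (hρ : 0 < symRatio f) {z : X} (hz : z ∈ interior (fdom f)) (M : ℝ) :
    ∃ R : ℝ, ∀ y ∈ interior (fdom f), realBreg f z y ≤ M → ‖y‖ ≤ R := by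
  obtain ⟨ρ, hρ0, hρ1⟩ := EReal.lt_iff_exists_real_btwn.1 hρ
  have hρ0 : 0 < ρ := by exact_mod_cast hρ0
  obtain ⟨R, hR⟩ := hf.exists_norm_le_of_isLocallyBoundedOnDom hsc.1
    (hf.grad_mem_subdiff (hG hz)) (M / ρ)
  refine ⟨max R ‖z‖, fun y hy hM => ?_⟩
  by_cases hzy : z = y
  · rw [hzy]
    exact le_max_right _ _
  refine (hR y (interior_subset hy) ?_).trans (le_max_left _ _)
  change realBreg f y z ≤ M / ρ
  have h1 : symRatio f ≤ breg f z y / breg f y z :=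
    (iInf₂_le z hz).trans ((iInf₂_le y hy).trans (iInf_le _ hzy))
  have h2 := hρ1.le.trans h1
  rw [hf.breg_eq (interior_subset hz) hy, hf.breg_eq (interior_subset hy) hz,
    ← EReal.coe_div, EReal.coe_le_coe_iff] at h2
  rw [le_div_iff₀ hρ0]
  have h3 := hf.realBreg_nonneg (interior_subset hy) (hG hz)
  have h4 := hf.realBreg_nonneg (interior_subset hz) (hG hy)
  rcases h3.eq_or_lt with h5 | h5
  · rw [← h5, zero_mul]
    exact h4.trans hM
  · rw [le_div_iff₀ h5] at h2
    linarith

end Boundedness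

/-! ### Solutions, iterates and the final assembly. -/

section Convergence

variable {X : Type*} [NormedAddCommGroup X] [NormedSpace ℝ X]
  {A B : X → Set (StrongDual ℝ X)} {f : X → EReal}

lemma setS_subset_setC : setS f A B ⊆ setC f A := by
  rintro z ⟨hz, hz'⟩
  obtain ⟨u, hu, -⟩ := hz'
  exact ⟨hz, ⟨u, hu⟩⟩

lemma neg_val_mem_of_mem_setS {z : X} (hz : z ∈ setS f A B) (hB : ∃! u, u ∈ B z) :
    -val B z ∈ A z := by
  obtain ⟨-, u, hu, v, hv, huv⟩ := hz
  have h : val B z = v := val_eq_of_subsingleton (fun a ha b hb => hB.unique ha hb) hv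
  rw [h, ← eq_neg_of_add_eq_zero_left huv]
  exact hu

/-- The iterates lie in `C`, and the elements of `A xₙ₊₁` that they produce. -/
lemma IsGenerated.mem_setC_and_mem {α : ℝ} {fs : ℕ → X → EReal} {γ : ℕ → ℝ} {x₀ : X}
    {x : ℕ → X} (hx : IsGenerated A B fs γ x₀ x) (hx₀ : x₀ ∈ setC f A) (hγ : ∀ n, 0 < γ n)
    (hfn : ∀ n, IsInCalpha α f (fs n)) (hB : ∀ x ∈ setC f A, ∃! u, u ∈ B x) :
    (∀ n, x n ∈ setC f A) ∧ ∀ n,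
      (γ n)⁻¹ • (grad (fs n) (x n) - grad (fs n) (x (n + 1))) - val B (x n) ∈ A (x (n + 1)) := by
  have hstep : ∀ n, x n ∈ setC f A → x (n + 1) ∈ setC f A ∧
      (γ n)⁻¹ • (grad (fs n) (x n) - grad (fs n) (x (n + 1))) - val B (x n) ∈ A (x (n + 1)) := by
    intro n hn
    obtain ⟨w, hw, hw'⟩ := hx.2 n
    rw [forwardOp_eq ((hfn n).gateaux hn.1) (hB _ hn), mem_singleton_iff] at hw
    obtain ⟨⟨u, hu⟩, hA⟩ := (mem_backwardOp_iff (hγ n)).1 hw'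
    refine ⟨⟨(hfn n).dom_eq ▸ hu.1, ⟨_, hA⟩⟩, ?_⟩
    convert! hA using 1
    rw [hw, sub_right_comm (grad (fs n) (x n)) (γ n • val B (x n)), smul_sub (γ n)⁻¹ _
      (γ n • val B (x n)), inv_smul_smul₀ (hγ n).ne']
  have hC : ∀ n, x n ∈ setC f A := by
    intro n
    induction n with
    | zero => exact hx.1 ▸ hx₀
    | succ n ih => exact (hstep n ih).1
  exact ⟨hC, fun n => (hstep n (hC n)).2⟩

end Convergence

end BregmanFB

theorem propositionp {X : Type*} [NormedAddCommGroup X] [NormedSpace ℝ X] [CompleteSpace X]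
    (hX : IsReflexiveSpace X)
    -- the problem
    (A B : X → Set (StrongDual ℝ X)) (hA : IsMaximallyMonotone A) (hB : IsMaximallyMonotone B)
    (f : X → EReal) (hf : IsGamma0 f) (hfs : IsEssSmooth f)
    (hCB : setC f A ⊆ interior (opDom B)) (hS : (setS f A B).Nonempty)
    (hB1 : ∀ x ∈ interior (opDom B), ∃! u, u ∈ B x)
    (δ₁ δ₂ κ : ℝ) (hδ₁ : δ₁ ∈ Set.Ico (0 : ℝ) 1) (hδ₂ : δ₂ ∈ Set.Icc (0 : ℝ) 1) (hκ : 0 ≤ κ)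
    (hineq : ∀ x ∈ setC f A, ∀ y ∈ setC f A, ∀ z ∈ setS f A B, ∀ y' ∈ A y, ∀ z' ∈ A z,
      (((val B y - val B z) (y - x) : ℝ) : EReal) ≤ (κ : EReal) * breg f x y +
        (((δ₁ • (y' - z') + δ₂ • (val B y - val B z)) (y - z) : ℝ) : EReal))
    -- the algorithm
    (α : ℝ) (hα : 0 < α) (γ : ℕ → ℝ) (hγ : ∀ n, 0 < γ n)
    (fs : ℕ → X → EReal) (hfn : ∀ n, IsInCalpha α f (fs n))
    (ha₁ : ∃ c : ℝ, 0 < c ∧ ∀ n, c ≤ γ n)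
    (ha₂ : ∀ n, κ * γ n ≤ α)
    (ha₃ : ∃ q : ℝ, q < 1 ∧ ∀ n, δ₁ * γ (n + 1) / γ n ≤ q)
    (hb : ∃ η : ℕ → ℝ, (∀ n, 0 ≤ η n) ∧ Summable η ∧
      ∀ n, ∀ x y : X, breg (fs (n + 1)) x y ≤ ((1 + η n : ℝ) : EReal) * breg (fs n) x y)
    (hc₁ : ∀ n, ∀ x ∈ setC f A, ∀ y ∈ setC f A, x ≠ y →
      0 < (grad (fs n) x - grad (fs n) y) (x - y))
    (hc₂ : ∀ n, ∀ x ∈ setC f A,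
      forwardOp (fs n) (γ n) B x ⊆ opRan (backwardOp (fs n) (γ n) A))
    (x₀ : X) (hx₀ : x₀ ∈ setC f A) :
    -- each step is uniquely defined at each point of `C` and leads back to `C`
    (∀ n, ∀ p ∈ setC f A, ∃ w, ∃ q ∈ setC f A,
      forwardOp (fs n) (γ n) B p = {w} ∧ opInv (backwardOp (fs n) (γ n) A) w = {q}) ∧
    (∃! x : ℕ → X, IsGenerated A B fs γ x₀ x) ∧
    ∀ x : ℕ → X, IsGenerated A B fs γ x₀ x →
      (∀ n, x n ∈ setC f A) ∧
      (∀ z ∈ setS f A B,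
        (∃ l : ℝ, Tendsto (fun n => breg (fs n) z (x n)) atTop (𝓝 (l : EReal))) ∧
        HasFiniteSum (fun n =>
          ((1 - κ * γ n / α : ℝ) : EReal) * breg (fs n) (x (n + 1)) (x n)) ∧
        HasFiniteSum (fun n =>
          ((1 - κ * γ n / α : ℝ) : EReal) * breg f (x (n + 1)) (x n)) ∧
        Summable (fun n =>
          ((γ n)⁻¹ • (grad (fs n) (x n) - grad (fs n) (x (n + 1))) - val B (x n) + val B z)
            (x (n + 1) - z)) ∧
        Summable (fun n => (1 - δ₂) * (val B (x n) - val B z) (x n - z))) ∧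
      ((Bornology.IsBounded (setC f A) ∨
        IsSupercoercive f ∨
        IsUniformlyConvex f ∨
        (IsEssStrictlyConvex f ∧ IsOpen (fdom (conj f)) ∧
          IsWeaklySeqContinuousOn (grad (conj f)) (fdom (conj f))) ∨
        (FiniteDimensional ℝ X ∧ IsOpen (fdom (conj f))) ∨
        (IsEssStrictlyConvex f ∧ 0 < symRatio f ∧ symRatio f < ⊤)) →
        Bornology.IsBounded (Set.range x)) := by
  have hB' : ∀ x ∈ setC f A, ∃! u, u ∈ B x := fun x hx => hB1 x (hCB hx)
  have hG : IsGateauxDiffOn f (interior (fdom f)) := hf.isGateauxDiffOn_interior hfs.2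
  have hstep : ∀ n, ∀ p ∈ setC f A, ∃ w, ∃ q ∈ setC f A,
      forwardOp (fs n) (γ n) B p = {w} ∧ opInv (backwardOp (fs n) (γ n) A) w = {q} := by
    intro n p hp
    obtain ⟨q, hq, h1, h2⟩ :=
      forwardBackward_step (hγ n) hA.prop (hfn n) hB' (hc₁ n) (hc₂ n) hp
    exact ⟨_, q, hq, h1, h2⟩
  refine ⟨hstep, existsUnique_isGenerated hx₀ hstep, fun x hx => ?_⟩
  obtain ⟨hxC, hxA⟩ := hx.mem_setC_and_mem hx₀ hγ hfn hB'
  obtain ⟨c, hc, hγc⟩ := ha₁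
  obtain ⟨q, hq, hγq⟩ := ha₃
  obtain ⟨η, hη, hηs, hηb⟩ := hb
  have hxi : ∀ n, x n ∈ interior (fdom f) := fun n => (hxC n).1
  have hxd : ∀ n, x n ∈ fdom f := fun n => interior_subset (hxi n)
  have hni : ∀ {n y}, y ∈ interior (fdom f) → y ∈ interior (fdom (fs n)) := fun {n y} hy =>
    (hfn n).dom_eq.symm ▸ hy
  have hnd : ∀ {n y}, y ∈ interior (fdom f) → y ∈ fdom (fs n) := fun hy =>
    interior_subset (hni hy)
  have hω : ∀ n, 0 ≤ 1 - κ * γ n / α := fun n => by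
    rw [sub_nonneg, div_le_one hα]
    exact ha₂ n
  have hD0 : ∀ {y w}, y ∈ interior (fdom f) → w ∈ interior (fdom f) → 0 ≤ realBreg f y w :=
    fun hy hw => hf.realBreg_nonneg (interior_subset hy) (hG hw)
  have hDα : ∀ n {y w}, y ∈ interior (fdom f) → w ∈ interior (fdom f) →
      α * realBreg f y w ≤ realBreg (fs n) y w := fun n y w hy hw =>
    (hfn n).mul_realBreg_le hf (interior_subset hy) hw
  have hDn0 : ∀ n {y w}, y ∈ interior (fdom f) → w ∈ interior (fdom f) →
      0 ≤ realBreg (fs n) y w := fun n y w hy hw =>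
    (mul_nonneg hα.le (hD0 hy hw)).trans (hDα n hy hw)
  have hmain : ∀ z ∈ setS f A B,
      (∃ l : ℝ, Tendsto (fun n => realBreg (fs n) z (x n)) atTop (𝓝 l)) ∧
      Summable (fun n => (1 - κ * γ n / α) * realBreg (fs n) (x (n + 1)) (x n)) ∧
      Summable (fun n =>
        ((γ n)⁻¹ • (grad (fs n) (x n) - grad (fs n) (x (n + 1))) - val B (x n) + val B z)
          (x (n + 1) - z)) ∧
      Summable (fun n => (1 - δ₂) * (val B (x n) - val B z) (x n - z)) := by
    intro z hz
    have hzC := setS_subset_setC hz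
    have hzA := neg_val_mem_of_mem_setS hz (hB' z hzC)
    obtain ⟨a₀, ha₀⟩ := hx₀.2
    -- No step precedes `x 0`, so an arbitrary element of `A x₀` starts the sequence.
    let xs : ℕ → StrongDual ℝ X := fun n => Nat.casesOn n a₀ fun n =>
      (γ n)⁻¹ • (grad (fs n) (x n) - grad (fs n) (x (n + 1))) - val B (x n)
    have hxs : ∀ n, xs n ∈ A (x n) := by
      rintro (_ | n)
      · rw [hx.1]
        exact ha₀
      · exact hxA n
    have hT : ∀ n, 0 ≤ (xs n + val B z) (x n - z) := fun n => by
      have := hA.prop _ _ _ (hxs n) _ hzA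
      rwa [sub_neg_eq_add] at this
    have hb : ∀ n, 0 ≤ (val B (x n) - val B z) (x n - z) := fun n =>
      hB.prop _ _ _ (val_mem (hB' _ (hxC n)).exists) _ (val_mem (hB' z hzC).exists)
    refine tendsto_and_summable_of_forwardBackward (T := fun n => (xs n + val B z) (x n - z))
      (fun n => hDn0 n hzC.1 (hxi n)) (fun n => hDn0 n (hxi _) (hxi n)) hT hb hω hη hηs hδ₂.2
      hc hγc hq hγq fun n => ?_
    have h1 : realBreg (fs (n + 1)) z (x (n + 1)) ≤
        (1 + η n) * realBreg (fs n) z (x (n + 1)) := by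
      have := hηb n z (x (n + 1))
      rw [(hfn _).gamma0.breg_eq (hnd hzC.1) (hni (hxi _)),
        (hfn _).gamma0.breg_eq (hnd hzC.1) (hni (hxi _))] at this
      exact_mod_cast this
    refine h1.trans (mul_le_mul_of_nonneg_left ?_ (by linarith [hη n]))
    have h2 := hineq _ (hxC (n + 1)) _ (hxC n) z hz _ (hxs n) _ hzA
    rw [hf.breg_eq (hxd _) (hxi n), sub_neg_eq_add] at h2
    have h2 : (val B (x n) - val B z) (x n - x (n + 1)) ≤ κ * realBreg f (x (n + 1)) (x n) +
        (δ₁ • (xs n + val B z) + δ₂ • (val B (x n) - val B z)) (x n - z) := by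
      exact_mod_cast h2
    rw [add_apply, smul_apply, smul_apply, smul_eq_mul, smul_eq_mul] at h2
    have h3 := realBreg_three_point (fs n) (x n) (x (n + 1)) z
    have h4 : γ n * (xs (n + 1) + val B z) (x (n + 1) - z) =
        (grad (fs n) (x n) - grad (fs n) (x (n + 1))) (x (n + 1) - z) -
          γ n * (val B (x n) - val B z) (x (n + 1) - z) := by
      have : xs (n + 1) + val B z =
          (γ n)⁻¹ • (grad (fs n) (x n) - grad (fs n) (x (n + 1))) -
            (val B (x n) - val B z) := by
        simp only [xs]
        abel
      rw [this, sub_apply (_ • _), smul_apply, smul_eq_mul, mul_sub,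
        mul_inv_cancel_left₀ (hγ n).ne']
    have h5 : (val B (x n) - val B z) (x (n + 1) - z) =
        (val B (x n) - val B z) (x n - z) - (val B (x n) - val B z) (x n - x (n + 1)) := by
      rw [← map_sub]
      congr 1
      abel
    -- Trades `D_f` for `D_{fₙ}`, which leaves the coefficient `1 - κγₙ/α`.
    have h6 : κ * γ n * realBreg f (x (n + 1)) (x n) ≤
        κ * γ n / α * realBreg (fs n) (x (n + 1)) (x n) := by
      have h7 := mul_le_mul_of_nonneg_left (hDα n (hxi (n + 1)) (hxi n))
        (div_nonneg (mul_nonneg hκ (hγ n).le) hα.le)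
      rwa [← mul_assoc, div_mul_cancel₀ _ hα.ne'] at h7
    have h8 := mul_le_mul_of_nonneg_left h2 (hγ n).le
    rw [h3, h4, h5]
    linarith
  refine ⟨hxC, fun z hz => ?_, fun hcases => ?_⟩
  · obtain ⟨⟨l, hl⟩, h2, h3, h4⟩ := hmain z hz
    have hzi := (setS_subset_setC hz).1
    refine ⟨⟨l, ?_⟩, ⟨_, fun n => ?_, h2⟩, ⟨fun n => (1 - κ * γ n / α) *
      realBreg f (x (n + 1)) (x n), fun n => ?_, ?_⟩, h3, h4⟩
    · refine ((continuous_coe_real_ereal.tendsto l).comp hl).congr fun n => ?_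
      exact ((hfn n).gamma0.breg_eq (hnd hzi) (hni (hxi n))).symm
    · beta_reduce
      rw [(hfn n).gamma0.breg_eq (hnd (hxi _)) (hni (hxi n)), EReal.coe_mul]
    · beta_reduce
      rw [hf.breg_eq (hxd _) (hxi n), EReal.coe_mul]
    · refine (h2.mul_left α⁻¹).of_nonneg_of_le
        (fun n => mul_nonneg (hω n) (hD0 (hxi _) (hxi n))) fun n => ?_
      rw [le_inv_mul_iff₀ hα, mul_left_comm]
      exact mul_le_mul_of_nonneg_left (hDα n (hxi _) (hxi n)) (hω n)
  · obtain ⟨z, hz⟩ := hS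
    have hzi := (setS_subset_setC hz).1
    obtain ⟨⟨l, hl⟩, -⟩ := hmain z hz
    obtain ⟨K, hK⟩ := hl.bddAbove_range
    -- Since `D_{fₙ} ≥ α D_f`, the iterates lie in one left Bregman ball of the fixed function `f`.
    have hM : ∀ n, realBreg f z (x n) ≤ K / α := fun n => by
      rw [le_div_iff₀ hα, mul_comm]
      exact (hDα n hzi (hxi n)).trans (hK ⟨n, rfl⟩)
    have hbdd : (∃ R : ℝ, ∀ y ∈ interior (fdom f), realBreg f z y ≤ K / α → ‖y‖ ≤ R) →
        Bornology.IsBounded (Set.range x) := by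
      rintro ⟨R, hR⟩
      refine isBounded_iff_forall_norm_le.2 ⟨R, ?_⟩
      rintro _ ⟨n, rfl⟩
      exact hR _ (hxi n) (hM n)
    rcases hcases with h | h | h | ⟨h1, h2, h3⟩ | ⟨h1, h2⟩ | ⟨h1, h2, -⟩
    · exact h.subset (range_subset_iff.2 hxC)
    · obtain ⟨R, hR⟩ := hf.exists_norm_le_of_isSupercoercive h hzi (K / α)
      exact hbdd ⟨R, fun y hy => hR y (hG hy)⟩
    · obtain ⟨R, hR⟩ := hf.exists_norm_le_of_isUniformlyConvex h (interior_subset hzi) (K / α)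
      exact hbdd ⟨R, fun y hy => hR y (hG hy)⟩
    · exact hf.isBounded_range_of_isWeaklySeqContinuousOn hX h1 h2 h3 hzi
        (fun n => hG (hxi n)) hM
    · exact hf.isBounded_range_of_finiteDimensional h2 hzi (fun n => hG (hxi n)) hM
    · exact hbdd (hf.exists_norm_le_of_symRatio_pos hG h1 h2 hzi (K / α))
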